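/- Let $p$ be a prime, let $A$ and $B$ be groups with subgroups $H\le A$ and $K\le B$, let $\varphi\colon H\to K$ be an isomorphism, and let $G=(A*B;\,H=K,\varphi)$ be the free product of $A$ and $B$ with $H$ and $K$ amalgamated according to $\varphi$; regard $A$ and $B$ as subgroups of $G$. A subgroup $F$ of a group $X$ is separable by a family $\Psi$ of normal subgroups of $X$ if $\bigcap_{N\in\Psi}FN=F$, and for $Y\le X$ the family $\Psi$ is called a $Y$-filtration if $\bigcap_{N\in\Psi}N=1$ and $Y$ is separable by $\Psi$. A subgroup $Y$ of $X$ is $p'$-isolated if, for every $g\in X$ and every prime $q\ne p$, $g^q\in Y$ implies $g\in Y$. A subgroup $F$ of $X$ is $p$-separable if for every $g\in X\setminus F$ there is a homomorphism $\psi$ of $X$ onto a finite $p$-group with $\psi(g)\notin\psi(F)$. Let $\Omega_A^p$ (respectively $\Omega_B^p$) be the family of all subgroups $A\cap N$ (respectively $B\cap N$), where $N$ is a normal subgroup of $G$ whose index is finite and a power of $p$. Let $\Lambda_A^p$ (respectively $\Lambda_B^p$) be the family of all $p'$-isolated cyclic subgroups of $A$ (respectively $B$) that are not separable by $\Omega_A^p$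 (respectively $\Omega_B^p$). **Theorem 1.6.** Suppose that $\Omega_A^p$ is an $H$-filtration and $\Omega_B^p$ is a $K$-filtration. Then every $p'$-isolated cyclic subgroup of $G$ that is not conjugate in $G$ to any subgroup in $\Lambda_A^p\cup\Lambda_B^p$ is $p$-separable. -/

import Mathlib

open scoped Pointwise

universe u v

/-- The free product `(A * B; H = K, φ)` of the groups `A` and `B` with the subgroups `H ≤ A` and
`K ≤ B` amalgamated according to the isomorphism `φ : H ≃* K`: the quotient of the free product
`A * B` by the normal closure of the elements `h (φ h)⁻¹`, for `h` in `H`. -/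
abbrev AmalgamatedProduct {A : Type u} {B : Type v} [Group A] [Group B]
    {H : Subgroup A} {K : Subgroup B} (φ : H ≃* K) : Type (max u v) :=
  Monoid.Coprod A B ⧸ Subgroup.normalClosure
    (Set.range fun h : H =>
      (Monoid.Coprod.inl (h : A) * (Monoid.Coprod.inr (φ h : B))⁻¹ : Monoid.Coprod A B))

namespace AmalgamatedProduct

variable {A : Type u} {B : Type v} [Group A] [Group B] {H : Subgroup A} {K : Subgroup B}

/-- The canonical map from the first factor `A` to the amalgamated product. -/
def inl (φ : H ≃* K) : A →* AmalgamatedProduct φ :=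
  (QuotientGroup.mk' _).comp Monoid.Coprod.inl

/-- The canonical map from the second factor `B` to the amalgamated product. -/
def inr (φ : H ≃* K) : B →* AmalgamatedProduct φ :=
  (QuotientGroup.mk' _).comp Monoid.Coprod.inr

end AmalgamatedProduct

/-- A subgroup `F` of `X` is separable by the family `Ψ` of subgroups of `X` if the
intersection of the sets `F N`, over `N` in `Ψ`, is `F`. -/
def SeparableByFamily {X : Type u} [Group X] (F : Subgroup X) (Ψ : Set (Subgroup X)) : Prop :=
  ⋂ N ∈ Ψ, (F : Set X) * (N : Set X) = (F : Set X)

/-- A family `Ψ` of normal subgroups of `X` is a `Y`-filtration if its intersection is trivial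
and the subgroup `Y` is separable by it. -/
def IsSubgroupFiltration {X : Type u} [Group X] (Ψ : Set (Subgroup X)) (Y : Subgroup X) : Prop :=
  (∀ N ∈ Ψ, N.Normal) ∧ sInf Ψ = ⊥ ∧ SeparableByFamily Y Ψ

/-- A subgroup `Y` of `X` is `p'`-isolated if, for every `g` in `X` and every prime `q ≠ p`,
`g ^ q ∈ Y` implies `g ∈ Y`. -/
def IsPPrimeIsolated {X : Type u} [Group X] (p : ℕ) (Y : Subgroup X) : Prop :=
  ∀ (g : X) (q : ℕ), q.Prime → q ≠ p → g ^ q ∈ Y → g ∈ Y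

/-- A subgroup `F` of `X` is `p`-separable if, for every `g ∉ F`, there is a homomorphism `ψ` of
`X` onto a finite `p`-group such that `ψ g` is not in the image of `F`. (Every finite group has a
copy in the universe of `X`.) -/
def IsPSeparable {X : Type u} [Group X] (p : ℕ) (F : Subgroup X) : Prop :=
  ∀ g : X, g ∉ F → ∃ (P : Type u) (_ : Group P) (ψ : X →* P),
    Finite P ∧ IsPGroup p P ∧ Function.Surjective ψ ∧ ψ g ∉ F.map ψ

/-- The family `Ω^p` of the pairs `(A ∩ N, B ∩ N)`, where `N` is a normal subgroup of the
amalgamated product of finite `p`-index (the index is a power of `p`). -/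
def omegaP {A : Type u} {B : Type v} [Group A] [Group B] {H : Subgroup A} {K : Subgroup B}
    (p : ℕ) (φ : H ≃* K) : Set (Subgroup A × Subgroup B) :=
  {RS | ∃ N : Subgroup (AmalgamatedProduct φ), N.Normal ∧ (∃ k : ℕ, N.index = p ^ k) ∧
    RS = (N.comap (AmalgamatedProduct.inl φ), N.comap (AmalgamatedProduct.inr φ))}

/-- The family `Ω_A^p` of the first components of the elements of `Ω^p`. -/
def omegaPLeft {A : Type u} {B : Type v} [Group A] [Group B] {H : Subgroup A} {K : Subgroup B}
    (p : ℕ) (φ : H ≃* K) : Set (Subgroup A) :=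
  Prod.fst '' omegaP p φ

/-- The family `Ω_B^p` of the second components of the elements of `Ω^p`. -/
def omegaPRight {A : Type u} {B : Type v} [Group A] [Group B] {H : Subgroup A} {K : Subgroup B}
    (p : ℕ) (φ : H ≃* K) : Set (Subgroup B) :=
  Prod.snd '' omegaP p φ

/-- The family `Λ_A^p` of the `p'`-isolated cyclic subgroups of `A` that are not separable by the
subgroups of `Ω_A^p`. -/
def lambdaPLeft {A : Type u} {B : Type v} [Group A] [Group B] {H : Subgroup A} {K : Subgroup B}
    (p : ℕ) (φ : H ≃* K) : Set (Subgroup A) :=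
  {L | IsCyclic L ∧ IsPPrimeIsolated p L ∧ ¬ SeparableByFamily L (omegaPLeft p φ)}

/-- The family `Λ_B^p` of the `p'`-isolated cyclic subgroups of `B` that are not separable by the
subgroups of `Ω_B^p`. -/
def lambdaPRight {A : Type u} {B : Type v} [Group A] [Group B] {H : Subgroup A} {K : Subgroup B}
    (p : ℕ) (φ : H ≃* K) : Set (Subgroup B) :=
  {L | IsCyclic L ∧ IsPPrimeIsolated p L ∧ ¬ SeparableByFamily L (omegaPRight p φ)}

/-- The subgroups `F` and `L` of `X` are conjugate in `X`. -/
def AreConjugate {X : Type u} [Group X] (F L : Subgroup X) : Prop :=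
  ∃ x : X, F = L.map (MulAut.conj x).toMonoidHom

/-!
Write `G` for the amalgamated product, and give every group its pro-`p` topology, whose basic open
subgroups are the normal subgroups of `p`-power index. A subgroup is `p`-separable if and only if it
is closed, so it has to be shown that the closure `pClosure p F` is contained in `F`.

*Virtually free quotients.* For a normal subgroup `N` of `p`-power index, let `Q = G / N`, let `D`
be the image in `Q` of the amalgamated subgroup, and let `CosetProduct D` be the semidirect product
of the free group on the cosets `Q / D` with `Q`. This is the HNN extension of `Q` with a stable
letter `t` that centralizes `D`. Hence `a ↦ a N` and `b ↦ t (b N) t⁻¹` define a homomorphism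
`θ_N` from `G` to `CosetProduct D` (`IsAmalgam.toCosetProduct`). A reduced alternating product whose
letters stay outside `H N` modulo `N` is mapped to an element with nontrivial free coordinate, since
that coordinate is visibly a reduced word in the cosets (`CosetProduct.left_ne_one`); the two
filtration hypotheses provide a suitable `N` for every reduced product. Free groups are residually
finite `p`-groups (`isResiduallyP_freeGroup`), so `CosetProduct D` is, and so is `G`.

*Subgroups of a factor.* If `F` is conjugate into a factor, say `F ≤ A`, then `θ_N` maps `A` to a
finite subgroup of `CosetProduct D`, and an element outside `A` is mapped outside it for a suitable
`N`; so the closure of `F` is contained in `A` (`IsAmalgam.pClosure_le_left`). Within `A`, the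
subgroup `F` is closed because it does not belong to `Λ_A^p`.

*Other cyclic subgroups.* Otherwise a generator `f` of `F` is conjugate to a cyclically reduced
product, and `θ_N f` has infinite order for some `N`. Let `g` be in the closure of `F`. It commutes
with `f`, as `G` is residually a finite `p`-group. Commuting elements of a free group lie in a
cyclic subgroup, so `u = g ^ l * f ^ (-t)` is in the kernel of `θ_N` for some `l ≠ 0` and `t`. For
`M ≤ N`, the elements `θ_M u` and `θ_M f` commute too, and since `θ_N u = 1` whereas `θ_N f` has
infinite order, `θ_M u` has finite order. But the closure of an infinite cyclic group in a residually
finite `p`-group contains no torsion (`eq_one_of_mem_pClosure_of_pow_eq_one`), so `θ_M u = 1` for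
all such `M`, which means that `u = 1`. The same absence of torsion, applied in `G`, improves the
equation `g ^ l = f ^ t` to `g ^ r ∈ F` for some `r` prime to `p`
(`exists_pow_mem_zpowers_of_mem_pClosure`), and then `g ∈ F` because `F` is `p'`-isolated.
-/

/-! ### The pro-`p` topology -/

/-- A normal subgroup whose index is a power of `p`: a basic open subgroup of the
pro-`p` topology. -/
def IsPNormal {X : Type*} [Group X] (p : ℕ) (N : Subgroup X) : Prop :=
  N.Normal ∧ ∃ k : ℕ, N.index = p ^ k

/-- A group is residually a finite `p`-group if its normal subgroups of `p`-power index
intersect trivially. -/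
def IsResiduallyP (p : ℕ) (X : Type*) [Group X] : Prop :=
  ∀ x : X, x ≠ 1 → ∃ N : Subgroup X, IsPNormal p N ∧ x ∉ N

/-- The closure of a subgroup in the pro-`p` topology. -/
def pClosure {X : Type*} [Group X] (p : ℕ) (F : Subgroup X) : Subgroup X :=
  ⨅ (N : Subgroup X) (_ : IsPNormal p N), F ⊔ N

section PNormal

variable {X Y : Type*} [Group X] [Group Y] {p : ℕ}

theorem mem_pClosure {F : Subgroup X} {g : X} :
    g ∈ pClosure p F ↔ ∀ N, IsPNormal p N → ∃ f ∈ F, f⁻¹ * g ∈ N := by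
  simp only [pClosure, Subgroup.mem_iInf]
  refine forall₂_congr fun N hN => ?_
  have := hN.1
  rw [Subgroup.mem_sup_of_normal_right]
  constructor
  · rintro ⟨y, hy, z, hz, rfl⟩
    exact ⟨y, hy, by simpa using hz⟩
  · rintro ⟨f, hf, h⟩
    exact ⟨f, hf, _, h, by simp⟩

theorem le_pClosure (F : Subgroup X) : F ≤ pClosure p F :=
  le_iInf₂ fun _ _ => le_sup_left

theorem IsPNormal.ker [Fact p.Prime] [Finite Y] (hY : IsPGroup p Y) (ψ : X →* Y) :
    IsPNormal p ψ.ker := by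
  refine ⟨inferInstance, ?_⟩
  rw [Subgroup.index_ker]
  exact IsPGroup.iff_card.1 (hY.to_subgroup ψ.range)

theorem IsPNormal.finiteIndex [Fact p.Prime] {N : Subgroup X} (hN : IsPNormal p N) :
    N.FiniteIndex := by
  obtain ⟨k, hk⟩ := hN.2
  exact ⟨by rw [hk]; exact pow_ne_zero _ (Fact.out : p.Prime).ne_zero⟩

theorem IsPNormal.isPGroup {N : Subgroup X} [N.Normal] (hN : IsPNormal p N) :
    IsPGroup p (X ⧸ N) := by
  obtain ⟨k, hk⟩ := hN.2
  exact IsPGroup.of_card (by rw [← Subgroup.index_eq_card, hk])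

theorem IsPNormal.comap [Fact p.Prime] {N : Subgroup Y} (hN : IsPNormal p N) (θ : X →* Y) :
    IsPNormal p (N.comap θ) := by
  have := hN.1
  have := hN.finiteIndex
  have h := IsPNormal.ker hN.isPGroup ((QuotientGroup.mk' N).comp θ)
  rwa [← MonoidHom.comap_ker, QuotientGroup.ker_mk'] at h

theorem IsPNormal.top : IsPNormal p (⊤ : Subgroup X) := ⟨inferInstance, 0, by simp⟩

theorem IsPNormal.inf [Fact p.Prime] {N M : Subgroup X} (hN : IsPNormal p N)
    (hM : IsPNormal p M) : IsPNormal p (N ⊓ M) := by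
  have := hN.1
  have := hM.1
  have := hN.finiteIndex
  have := hM.finiteIndex
  have hP : IsPGroup p ((X ⧸ N) × (X ⧸ M)) := by
    obtain ⟨a, ha⟩ := IsPGroup.iff_card.1 hN.isPGroup
    obtain ⟨b, hb⟩ := IsPGroup.iff_card.1 hM.isPGroup
    exact IsPGroup.of_card (n := a + b) (by rw [Nat.card_prod, ha, hb, pow_add])
  have h := IsPNormal.ker hP ((QuotientGroup.mk' N).prod (QuotientGroup.mk' M))
  rwa [MonoidHom.ker_prod, QuotientGroup.ker_mk', QuotientGroup.ker_mk'] at h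

theorem IsPNormal.exists_pow_mem {N : Subgroup X} (hN : IsPNormal p N) :
    ∃ k : ℕ, ∀ x : X, x ^ p ^ k ∈ N := by
  have := hN.1
  obtain ⟨k, hk⟩ := hN.2
  exact ⟨k, fun x => hk ▸ N.pow_index_mem x⟩

/-- Finitely many points are separated simultaneously by one normal subgroup of `p`-power index,
provided the property that separates each of them passes to smaller subgroups. -/
theorem IsPNormal.exists_forall_finite [Fact p.Prime] {ι : Type*} {s : Set ι} (hs : s.Finite)
    {r : ι → Subgroup X → Prop} (hr : ∀ i M N, M ≤ N → r i N → r i M)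
    (h : ∀ i ∈ s, ∃ N, IsPNormal p N ∧ r i N) : ∃ N, IsPNormal p N ∧ ∀ i ∈ s, r i N := by
  induction s, hs using Set.Finite.induction_on with
  | empty => exact ⟨⊤, .top, by simp⟩
  | @insert a s _ _ ih =>
    obtain ⟨N, hN, hs⟩ := ih fun i hi => h i (Set.mem_insert_of_mem _ hi)
    obtain ⟨M, hM, ha⟩ := h a (Set.mem_insert _ _)
    refine ⟨N ⊓ M, hN.inf hM, ?_⟩
    rintro i (rfl | hi)
    · exact hr _ _ _ inf_le_right ha
    · exact hr _ _ _ inf_le_left (hs i hi)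

theorem map_mem_pClosure [Fact p.Prime] (θ : X →* Y) {F : Subgroup X} {g : X}
    (hg : g ∈ pClosure p F) : θ g ∈ pClosure p (F.map θ) := by
  rw [mem_pClosure] at hg ⊢
  intro N hN
  obtain ⟨f, hf, h⟩ := hg _ (hN.comap θ)
  exact ⟨θ f, Subgroup.mem_map_of_mem θ hf, by simpa using h⟩

/-- Separation from a closed subgroup in the pro-`p` topology is separation in a finite
`p`-quotient. -/
theorem isPSeparable_of_pClosure_le {X : Type u} [Group X] {p : ℕ} [Fact p.Prime]
    {F : Subgroup X} (h : pClosure p F ≤ F) : IsPSeparable p F := by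
  intro g hg
  have hg' : g ∉ pClosure p F := fun hc => hg (h hc)
  rw [mem_pClosure] at hg'
  push Not at hg'
  obtain ⟨N, hN, hgN⟩ := hg'
  have := hN.1
  have := hN.finiteIndex
  refine ⟨X ⧸ N, inferInstance, QuotientGroup.mk' N, inferInstance, hN.isPGroup,
    QuotientGroup.mk'_surjective N, ?_⟩
  rintro ⟨f, hf, hfg⟩
  exact hgN f hf (QuotientGroup.eq.1 hfg)

theorem pClosure_map_conj [Fact p.Prime] (F : Subgroup X) (x : X)
    (h : pClosure p (F.map (MulAut.conj x).toMonoidHom) ≤ F.map (MulAut.conj x).toMonoidHom) :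
    pClosure p F ≤ F := by
  intro g hg
  obtain ⟨f, hf, hfg⟩ := h (map_mem_pClosure (MulAut.conj x).toMonoidHom hg)
  rwa [← (MulAut.conj x).injective hfg]

/-- In a residually finite `p`-group, the closure of a cyclic subgroup centralizes it. -/
theorem commute_of_mem_pClosure (hX : IsResiduallyP p X) {f g : X}
    (hg : g ∈ pClosure p (Subgroup.zpowers f)) : Commute f g := by
  rw [mem_pClosure] at hg
  by_contra hne
  obtain ⟨N, hN, hx⟩ := hX ((f * g) * (g * f)⁻¹) fun h => hne (mul_inv_eq_one.1 h)
  have := hN.1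
  obtain ⟨_, ⟨k, rfl⟩, hk⟩ := hg N hN
  apply hx
  rw [← QuotientGroup.eq_one_iff]
  have : (f : X ⧸ N) ^ k = g := by simpa using QuotientGroup.eq.2 hk
  change (f : X ⧸ N) * g * ((g : X ⧸ N) * f)⁻¹ = 1
  rw [mul_inv_eq_one, ← this]
  exact ((Commute.refl _).zpow_right _).eq

theorem pow_dvd_of_zpow_mem [Fact p.Prime] {N : Subgroup X} (hN : IsPNormal p N) {f : X}
    {m : ℕ} (hm : f ^ p ^ m ∉ N) {a : ℤ} (ha : f ^ a ∈ N) : (p : ℤ) ^ (m + 1) ∣ a := by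
  have := hN.1
  have := hN.finiteIndex
  obtain ⟨k, hk⟩ := IsPGroup.iff_orderOf.1 hN.isPGroup (f : X ⧸ N)
  have h1 : (f : X ⧸ N) ^ a = 1 := (QuotientGroup.eq_one_iff _).2 ha
  have h2 : ¬ (f : X ⧸ N) ^ p ^ m = 1 := fun h => hm ((QuotientGroup.eq_one_iff _).1 h)
  rw [← orderOf_dvd_iff_zpow_eq_one, hk] at h1
  rw [← orderOf_dvd_iff_pow_eq_one, hk,
    Nat.pow_dvd_pow_iff_le_right (Fact.out : p.Prime).one_lt] at h2
  refine dvd_trans ?_ h1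
  push_cast
  exact pow_dvd_pow _ (by omega)

/-- In a residually finite `p`-group, the closure of an infinite cyclic subgroup contains no
torsion. -/
theorem eq_one_of_mem_pClosure_of_pow_eq_one [Fact p.Prime] (hX : IsResiduallyP p X) {f v : X}
    (hf : ∀ n : ℕ, n ≠ 0 → f ^ n ≠ 1) (hv : v ∈ pClosure p (Subgroup.zpowers f))
    {n : ℕ} (hn : n ≠ 0) (hvn : v ^ n = 1) : v = 1 := by
  have hp : p.Prime := Fact.out
  have hcomm := commute_of_mem_pClosure hX hv
  by_contra hne
  obtain ⟨N₀, hN₀, hvN⟩ := hX v hne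
  obtain ⟨c, hc⟩ := hN₀.exists_pow_mem
  obtain ⟨e, n', hn', rfl⟩ := Nat.exists_eq_pow_mul_and_not_dvd hn p hp.ne_one
  -- In a quotient where the order of `f` exceeds `p ^ (c + e)`, an exponent `j` with
  -- `f ^ j = v` is divisible by `p ^ c`, so that `f ^ j` dies modulo `N₀`, but `v` does not.
  obtain ⟨N₁, hN₁, hfN⟩ := hX _ (hf (p ^ (c + e)) (pow_ne_zero _ hp.ne_zero))
  obtain ⟨_, ⟨j, rfl⟩, hj⟩ := mem_pClosure.1 hv _ (hN₀.inf hN₁)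
  have := hN₁.1
  have hj1 : (f : X ⧸ N₁) ^ j = v := by simpa using QuotientGroup.eq.2 hj.2
  have hmem : f ^ (j * (p ^ e * n' : ℕ)) ∈ N₁ := by
    rw [← QuotientGroup.eq_one_iff]
    have : (f : X ⧸ N₁) ^ (j * (p ^ e * n' : ℕ)) = 1 := by
      rw [zpow_mul, hj1, zpow_natCast, ← QuotientGroup.mk_pow, hvn, QuotientGroup.mk_one]
    exact this
  have hdvd := pow_dvd_of_zpow_mem hN₁ hfN hmem
  have hpj : (p : ℤ) ^ c ∣ j := by
    have h1 : (p : ℤ) ^ e * (p : ℤ) ^ c ∣ (p : ℤ) ^ e * (j * n') := by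
      rw [← pow_add]
      refine (pow_dvd_pow _ (by omega)).trans (hdvd.trans (dvd_of_eq ?_))
      push_cast; ring
    have h2 := (mul_dvd_mul_iff_left (pow_ne_zero e (by exact_mod_cast hp.ne_zero))).1 h1
    refine IsCoprime.dvd_of_dvd_mul_right ?_ h2
    exact IsCoprime.pow_left (Nat.isCoprime_iff_coprime.2 (hp.coprime_iff_not_dvd.2 hn'))
  obtain ⟨i, rfl⟩ := hpj
  apply hvN
  have h0 : f ^ ((p : ℤ) ^ c * i) ∈ N₀ := by
    rw [zpow_mul]
    exact N₀.zpow_mem (by exact_mod_cast hc f) i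
  simpa using N₀.mul_mem h0 hj.1

/-- In a residually finite `p`-group, an element of the closure of an infinite cyclic subgroup
which has a power with nonzero exponent in it has such a power with exponent prime to `p`. -/
theorem exists_pow_mem_zpowers_of_mem_pClosure [Fact p.Prime] (hX : IsResiduallyP p X) {f g : X}
    (hf : ∀ n : ℕ, n ≠ 0 → f ^ n ≠ 1) (hg : g ∈ pClosure p (Subgroup.zpowers f))
    {l : ℕ} (hl : l ≠ 0) {t : ℤ} (hgt : g ^ l = f ^ t) :
    ∃ r : ℕ, r ≠ 0 ∧ ¬ p ∣ r ∧ g ^ r ∈ Subgroup.zpowers f := by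
  have hp : p.Prime := Fact.out
  have hcomm := commute_of_mem_pClosure hX hg
  obtain ⟨a, r, hr, rfl⟩ := Nat.exists_eq_pow_mul_and_not_dvd hl p hp.ne_one
  refine ⟨r, by rintro rfl; simp at hr, hr, ?_⟩
  obtain ⟨N, hN, hfN⟩ := hX _ (hf (p ^ a) (pow_ne_zero _ hp.ne_zero))
  obtain ⟨_, ⟨k, rfl⟩, hk⟩ := mem_pClosure.1 hg _ hN
  have := hN.1
  have hk1 : (f : X ⧸ N) ^ k = g := by simpa using QuotientGroup.eq.2 hk
  have hmem : f ^ (k * (p ^ a * r : ℕ) - t) ∈ N := by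
    rw [← QuotientGroup.eq_one_iff]
    have : (f : X ⧸ N) ^ (k * (p ^ a * r : ℕ) - t) = 1 := by
      rw [zpow_sub, zpow_mul, hk1, zpow_natCast, ← QuotientGroup.mk_pow, hgt,
        QuotientGroup.mk_zpow, mul_inv_cancel]
    exact this
  have hdvd : (p : ℤ) ^ a ∣ t := by
    have h1 := (pow_dvd_pow (p : ℤ) a.le_succ).trans (pow_dvd_of_zpow_mem hN hfN hmem)
    have h2 : (p : ℤ) ^ a ∣ k * (p ^ a * r : ℕ) := ⟨k * r, by push_cast; ring⟩
    exact (dvd_sub_right h2).1 h1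
  obtain ⟨s, rfl⟩ := hdvd
  have hfs : f ^ s ∈ Subgroup.zpowers f := ⟨s, rfl⟩
  have h1 : g ^ r * (f ^ s)⁻¹ = 1 := by
    refine eq_one_of_mem_pClosure_of_pow_eq_one hX hf ?_ (pow_ne_zero a hp.ne_zero) ?_
    · exact mul_mem (pow_mem hg _) (inv_mem (le_pClosure _ hfs))
    · have hc : Commute (g ^ r) (f ^ s)⁻¹ := ((hcomm.symm.pow_left r).zpow_right s).inv_right
      rw [hc.mul_pow, ← pow_mul, mul_comm r, hgt, inv_pow, ← zpow_natCast, ← zpow_mul]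
      push_cast
      rw [mul_comm s, mul_inv_cancel]
  rw [mul_inv_eq_one.1 h1]
  exact hfs

theorem IsPPrimeIsolated.mem_of_pow_mem {F : Subgroup X} (hF : IsPPrimeIsolated p F) {g : X}
    {r : ℕ} (hr : r ≠ 0) (hpr : ¬ p ∣ r) (h : g ^ r ∈ F) : g ∈ F := by
  induction r using Nat.recOnMul generalizing g with
  | zero => exact absurd rfl hr
  | one => simpa using h
  | prime q hq => exact hF g q hq (by rintro rfl; exact hpr dvd_rfl) h
  | mul a b iha ihb =>
    rw [pow_mul] at h
    exact iha (by rintro rfl; simp at hr) (fun h => hpr (h.mul_right b))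
      (ihb (by rintro rfl; simp at hr) (fun h => hpr (h.mul_left a)) h)

end PNormal

/-! ### Free groups are residually finite `p`-groups -/

section Unitriangular

open Matrix

variable (n : ℕ) (R : Type*) [CommRing R]

/-- The strictly upper triangular matrices. -/
def strictlyUpperTriangular : AddSubgroup (Matrix (Fin n) (Fin n) R) where
  carrier := {M | ∀ i j, j ≤ i → M i j = 0}
  zero_mem' := by simp
  add_mem' {a b} ha hb i j hij := by simp [ha i j hij, hb i j hij]
  neg_mem' {a} ha i j hij := by simp [ha i j hij]

variable {n R}

theorem mul_mem_strictlyUpperTriangular {a b : Matrix (Fin n) (Fin n) R}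
    (ha : a ∈ strictlyUpperTriangular n R) (hb : b ∈ strictlyUpperTriangular n R) :
    a * b ∈ strictlyUpperTriangular n R := by
  intro i j hij
  rw [Matrix.mul_apply]
  refine Finset.sum_eq_zero fun k _ => ?_
  rcases le_or_gt k i with hk | hk
  · rw [ha i k hk, zero_mul]
  · rw [hb k j (hij.trans hk.le), mul_zero]

theorem isUnit_one_add_of_mem_strictlyUpperTriangular {a : Matrix (Fin n) (Fin n) R}
    (ha : a ∈ strictlyUpperTriangular n R) : IsUnit (1 + a) := by
  rw [Matrix.isUnit_iff_isUnit_det, Matrix.det_of_isUpperTriangular]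
  · simp [ha _ _ le_rfl]
  · intro i j hij
    have hij' : j < i := hij
    simp [ha i j hij'.le, Matrix.one_apply_ne hij'.ne']

variable (n R)

/-- The group of the upper triangular matrices with ones on the diagonal. -/
def unitriangular [Finite R] : Subgroup (Matrix (Fin n) (Fin n) R)ˣ :=
  let S : Submonoid (Matrix (Fin n) (Fin n) R)ˣ :=
    { carrier := {u | u.val - 1 ∈ strictlyUpperTriangular n R}
      one_mem' := by simp
      mul_mem' := fun {a b} ha hb => by
        have h : (a * b).val - 1 = (a.val - 1) * (b.val - 1) + (a.val - 1) + (b.val - 1) := by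
          rw [Units.val_mul]; noncomm_ring
        change (a * b).val - 1 ∈ strictlyUpperTriangular n R
        rw [h]
        exact add_mem (add_mem (mul_mem_strictlyUpperTriangular ha hb) ha) hb }
  { S with
    inv_mem' := fun {u} hu => by
      -- The group of units is finite, so the inverse of `u` is a power of `u`.
      have h : u⁻¹ = u ^ (orderOf u - 1) := by
        rw [inv_eq_iff_mul_eq_one, ← pow_succ', Nat.sub_add_cancel (orderOf_pos u),
          pow_orderOf_eq_one]
      rw [h]
      exact S.pow_mem hu _ }

theorem isPGroup_unitriangular (p s : ℕ) [Fact p.Prime] :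
    IsPGroup p (unitriangular n (ZMod (p ^ s))) := by
  have e : unitriangular n (ZMod (p ^ s)) ≃ strictlyUpperTriangular n (ZMod (p ^ s)) :=
    { toFun := fun u => ⟨u.val.val - 1, u.2⟩
      invFun := fun a => ⟨(isUnit_one_add_of_mem_strictlyUpperTriangular a.2).unit, by
        change _ - 1 ∈ strictlyUpperTriangular n (ZMod (p ^ s))
        simp⟩
      left_inv := fun u => by ext; simp
      right_inv := fun a => by ext; simp }
  have h : Nat.card (strictlyUpperTriangular n (ZMod (p ^ s))) ∣ p ^ (s * (n * n)) := by
    refine (AddSubgroup.card_addSubgroup_dvd_card _).trans (dvd_of_eq ?_)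
    simp [Matrix, ← pow_mul, mul_assoc]
  exact IsPGroup.of_card_dvd_pow (Nat.card_congr e ▸ h)

end Unitriangular

section SquareZero

variable {R : Type*} [Ring R]

/-- The unit `1 + N` for an element `N` of square zero. -/
def unitOfSqZero (N : R) (h : N * N = 0) : Rˣ where
  val := 1 + N
  inv := 1 - N
  val_inv := by noncomm_ring; simp [h]
  inv_val := by noncomm_ring; simp [h]

theorem unitOfSqZero_zpow (N : R) (h : N * N = 0) (e : ℤ) :
    ((unitOfSqZero N h ^ e : Rˣ) : R) = 1 + (e : R) * N := by
  induction e with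
  | zero => simp
  | succ k ih =>
    rw [zpow_add_one, Units.val_mul, ih]
    simp only [unitOfSqZero]
    have : ((k : ℤ) : R) * N * N = 0 := by rw [mul_assoc, h, mul_zero]
    rw [mul_add, add_mul, add_mul, this]
    push_cast
    noncomm_ring
  | pred k ih =>
    rw [zpow_sub_one, Units.val_mul, ih]
    change _ * (1 - N) = _
    have : ((-(k : ℤ) : ℤ) : R) * N * N = 0 := by rw [mul_assoc, h, mul_zero]
    rw [mul_sub, add_mul, add_mul, this]
    push_cast
    noncomm_ring

end SquareZero

namespace FreeGroup

variable {X : Type*}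

theorem exists_syllables (g : FreeGroup X) : ∃ L : List (X × ℤ),
    g = (L.map fun s => of s.1 ^ s.2).prod ∧ (∀ s ∈ L, s.2 ≠ 0) ∧
      L.IsChain fun s t => s.1 ≠ t.1 := by
  have key : ∀ (x : X) (e : ℤ) (L : List (X × ℤ)), (∀ s ∈ L, s.2 ≠ 0) →
      (L.IsChain fun s t => s.1 ≠ t.1) → ∃ L' : List (X × ℤ),
        of x ^ e * (L.map fun s => of s.1 ^ s.2).prod = (L'.map fun s => of s.1 ^ s.2).prod ∧
        (∀ s ∈ L', s.2 ≠ 0) ∧ L'.IsChain fun s t => s.1 ≠ t.1 := by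
    intro x e L h0 hL
    by_cases he : e = 0
    · exact ⟨L, by simp [he], h0, hL⟩
    match L with
    | [] => exact ⟨[(x, e)], by simp, by simpa using he, by simp⟩
    | (y, d) :: L =>
      by_cases hxy : x = y
      · subst hxy
        by_cases hed : e + d = 0
        · refine ⟨L, ?_, fun s hs => h0 s (List.mem_cons_of_mem _ hs), hL.tail⟩
          simp [← mul_assoc, ← zpow_add, hed]
        · refine ⟨(x, e + d) :: L, by simp [zpow_add, mul_assoc], ?_, ?_⟩
          · intro s hs
            rcases List.mem_cons.1 hs with rfl | hs
            · exact hed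
            · exact h0 s (List.mem_cons_of_mem _ hs)
          · rw [List.isChain_cons] at hL ⊢
            exact hL
      · refine ⟨(x, e) :: (y, d) :: L, by simp, ?_, ?_⟩
        · intro s hs
          rcases List.mem_cons.1 hs with rfl | hs
          · exact he
          · exact h0 s hs
        · exact List.isChain_cons_cons.2 ⟨hxy, hL⟩
  obtain ⟨w, rfl⟩ := Quot.exists_rep g
  induction w with
  | nil => exact ⟨[], rfl, by simp, by simp⟩
  | cons a w ih =>
    obtain ⟨L, h, h0, hL⟩ := ih
    obtain ⟨x, b⟩ := a
    obtain ⟨L', h', h0', hL'⟩ := key x (if b then 1 else -1) L h0 hL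
    refine ⟨L', ?_, h0', hL'⟩
    rw [← h', ← h]
    cases b
    · simp [of, inv_mk, invRev]
    · simp [of]

/-- Matrix with entries `1` at those places `(i, i + 1)` for which the letter of the `i`-th
syllable of `L` is `x`. -/
noncomputable def syllableMatrix (R : Type*) [Zero R] [One R] (L : List (X × ℤ)) (x : X) :
    Matrix (Fin (L.length + 1)) (Fin (L.length + 1)) R := by
  classical
  exact fun i j => if ∃ h : i.1 < L.length, L[i.1].1 = x ∧ j.1 = i.1 + 1 then 1 else 0

theorem syllableMatrix_mul_self (R : Type*) [CommRing R] {L : List (X × ℤ)}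
    (hL : L.IsChain fun s t => s.1 ≠ t.1) (x : X) :
    syllableMatrix R L x * syllableMatrix R L x = 0 := by
  ext i j
  rw [Matrix.mul_apply]
  refine Finset.sum_eq_zero fun k _ => ?_
  by_contra hne
  obtain ⟨h1, h2⟩ := ne_zero_and_ne_zero_of_mul hne
  simp only [syllableMatrix, ne_eq, ite_eq_right_iff, not_forall] at h1 h2
  obtain ⟨⟨hi, hix, hk⟩, -⟩ := h1
  obtain ⟨⟨hk', hkx, -⟩, -⟩ := h2
  refine List.isChain_iff_getElem.1 hL i (by omega) ?_
  rw [hix, ← hkx]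
  simp only [hk]

end FreeGroup

/-- Free groups are residually finite `p`-groups. A reduced product of `k` syllables `x ^ e` is
detected by the unitriangular matrices of size `k + 1` over `ℤ / p ^ s`, if each `x` is sent to the
matrix with ones at those places `(i, i + 1)` where `x` is the letter of the `i`-th syllable: its
entry in the upper right corner is then the product of all the exponents. -/
theorem isResiduallyP_freeGroup (p : ℕ) [Fact p.Prime] (X : Type*) :
    IsResiduallyP p (FreeGroup X) := by
  intro g hg
  obtain ⟨L, hgL, h0, hL⟩ := g.exists_syllables
  set d : ℤ := (L.map Prod.snd).prod with hd
  have hd0 : d ≠ 0 := by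
    rw [hd, Ne, List.prod_eq_zero_iff]
    intro h
    obtain ⟨s, hs, hs0⟩ := List.mem_map.1 h
    exact h0 s hs hs0
  set s := d.natAbs
  let R := ZMod (p ^ s)
  have hds : (d : R) ≠ 0 := by
    rw [Ne, ZMod.intCast_zmod_eq_zero_iff_dvd, Int.natCast_dvd]
    exact Nat.not_dvd_of_pos_of_lt (by omega) (Nat.lt_pow_self (Fact.out : p.Prime).one_lt)
  let u : X → (Matrix (Fin (L.length + 1)) (Fin (L.length + 1)) R)ˣ := fun x =>
    unitOfSqZero _ (FreeGroup.syllableMatrix_mul_self R hL x)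
  have hu : ∀ x, u x ∈ unitriangular (L.length + 1) R := by
    intro x i j hij
    have : (u x).val - 1 = FreeGroup.syllableMatrix R L x := add_sub_cancel_left _ _
    rw [this]
    simp only [FreeGroup.syllableMatrix, ite_eq_right_iff]
    rintro ⟨-, -, h⟩
    exact absurd hij (by rw [Fin.le_def]; omega)
  let ψ : FreeGroup X →* unitriangular (L.length + 1) R := FreeGroup.lift fun x => ⟨u x, hu x⟩
  refine ⟨ψ.ker, .ker (isPGroup_unitriangular _ p s) ψ, ?_⟩
  have hrow : ∀ (k : ℕ) (hk : k ≤ L.length),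
      (ψ ((L.take k).map fun s => FreeGroup.of s.1 ^ s.2).prod).val.val 0 ⟨k, by omega⟩ =
        (((L.take k).map Prod.snd).prod : ℤ) ∧
      ∀ j : Fin (L.length + 1), k < j.1 →
        (ψ ((L.take k).map fun s => FreeGroup.of s.1 ^ s.2).prod).val.val 0 j = 0 := by
    intro k
    induction k with
    | zero =>
      intro _
      refine ⟨by simp, fun j hj => ?_⟩
      simp only [List.take_zero, List.map_nil, List.prod_nil, map_one, OneMemClass.coe_one,
        Units.val_one]
      exact Matrix.one_apply_ne (by rintro rfl; simp at hj)
    | succ k ih =>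
      intro hk
      obtain ⟨ih1, ih2⟩ := ih (by omega)
      set Q := ψ ((L.take k).map fun s => FreeGroup.of s.1 ^ s.2).prod
      have hstep : (ψ ((L.take (k + 1)).map fun s => FreeGroup.of s.1 ^ s.2).prod).val.val =
          Q.val.val + ((L[k].2 : ℤ) : Matrix _ _ R) *
            (Q.val.val * FreeGroup.syllableMatrix R L L[k].1) := by
        rw [List.take_succ_eq_append_getElem (by omega)]
        simp only [List.map_append, List.prod_append, map_mul, List.map_cons, List.map_nil,
          List.prod_cons, List.prod_nil, mul_one, map_zpow, ψ, FreeGroup.lift_apply_of,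
          Subgroup.coe_mul, Units.val_mul, SubgroupClass.coe_zpow, u, unitOfSqZero_zpow]
        rw [mul_add, mul_one, ← mul_assoc, ← mul_assoc, (Int.cast_commute _ _).eq]
      have hentry : ∀ j : Fin (L.length + 1), k < j.1 →
          (Q.val.val * FreeGroup.syllableMatrix R L L[k].1) 0 j =
            if j.1 = k + 1 then ((((L.take k).map Prod.snd).prod : ℤ) : R) else 0 := by
        intro j hj
        rw [Matrix.mul_apply, Finset.sum_eq_single ⟨k, by omega⟩]
        · rw [ih1]
          simp [FreeGroup.syllableMatrix, show k < L.length by omega]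
        · intro i _ hi
          rcases lt_or_gt_of_ne (fun h => hi (Fin.ext h) : i.1 ≠ k) with h | h
          · have : FreeGroup.syllableMatrix R L L[k].1 i j = 0 := by
              simp only [FreeGroup.syllableMatrix, ite_eq_right_iff]
              rintro ⟨-, -, h⟩
              omega
            rw [this, mul_zero]
          · rw [ih2 i h, zero_mul]
        · simp
      have hprod : ((L.take (k + 1)).map Prod.snd).prod =
          L[k].2 * ((L.take k).map Prod.snd).prod := by
        rw [List.take_succ_eq_append_getElem (by omega), List.map_append, List.prod_append,
          List.map_singleton, List.prod_singleton, mul_comm]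
      constructor
      · rw [hstep, Matrix.add_apply, ih2 _ (by simp), ← zsmul_eq_mul, Matrix.smul_apply,
          hentry _ (by simp), hprod]
        simp [-List.map_take]
      · intro j hj
        rw [hstep, Matrix.add_apply, ih2 _ (by omega), ← zsmul_eq_mul, Matrix.smul_apply,
          hentry _ (by omega), if_neg (by omega)]
        simp
  intro hker
  rw [MonoidHom.mem_ker] at hker
  have hL0 : 0 < L.length := by
    rw [List.length_pos_iff]
    rintro rfl
    exact hg (by simpa using hgL)
  have h1 := (hrow L.length le_rfl).1
  rw [List.take_length, ← hgL, hker] at h1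
  apply hds
  rw [← h1]
  exact Matrix.one_apply_ne (by rw [Ne, Fin.ext_iff]; simp; omega)

/-! ### Semidirect products of free groups and finite groups -/

section SemidirectProduct

variable {V Q : Type*} [Group V] [Group Q] (α : Q →* MulAut V)

/-- A homomorphism `ν : V →* P` extends to a homomorphism from `V ⋊ Q` to the wreath product of
`P` and `Q`, which records the composites of `ν` with all the automorphisms of `V` given by `Q`. -/
def SemidirectProduct.toWreathProduct {P : Type*} [Group P] (ν : V →* P) :
    V ⋊[α] Q →* P ≀ᵣ Q where
  toFun x := ⟨fun q => ν (α q⁻¹ x.left), x.right⟩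
  map_one' := by ext <;> simp
  map_mul' x y := by
    ext q
    · have h : α q⁻¹ * α x.right = α (x.right⁻¹ * q)⁻¹ := by
        rw [← map_mul, mul_inv_rev, inv_inv]
      simp only [SemidirectProduct.mul_left, map_mul, RegularWreathProduct.mul_left,
        Pi.mul_apply, ← h, MulAut.mul_apply]
    · simp

theorem isResiduallyP_semidirectProduct {p : ℕ} [Fact p.Prime] [Finite Q] (hQ : IsPGroup p Q)
    (hV : IsResiduallyP p V) : IsResiduallyP p (V ⋊[α] Q) := by
  intro x hx
  by_cases hr : x.right = 1
  · have hl : x.left ≠ 1 := fun h => hx (SemidirectProduct.ext h hr)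
    obtain ⟨N, hN, hxN⟩ := hV _ hl
    have := hN.1
    have := hN.finiteIndex
    have hP : IsPGroup p ((V ⧸ N) ≀ᵣ Q) := by
      obtain ⟨a, ha⟩ := IsPGroup.iff_card.1 hN.isPGroup
      obtain ⟨b, hb⟩ := IsPGroup.iff_card.1 hQ
      refine IsPGroup.of_card (n := a * Nat.card Q + b) ?_
      rw [RegularWreathProduct.card, ha, ← pow_mul, pow_add]
      congr 1
    refine ⟨_, .ker hP (SemidirectProduct.toWreathProduct α (QuotientGroup.mk' N)), fun h => ?_⟩
    have h1 := congrFun (congrArg RegularWreathProduct.left (MonoidHom.mem_ker.1 h)) 1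
    have h2 : QuotientGroup.mk' N x.left = 1 := by
      have h3 : α (1 : Q)⁻¹ x.left = x.left := by rw [inv_one, map_one, MulAut.one_apply]
      rw [← h3]
      exact h1
    exact hxN ((QuotientGroup.eq_one_iff _).1 h2)
  · exact ⟨_, .ker hQ SemidirectProduct.rightHom, hr⟩

end SemidirectProduct

/-- Commuting elements of a free group are powers of a common element: the subgroup that they
generate is commutative, and it is free by the Nielsen–Schreier theorem. -/
theorem FreeGroup.exists_zpow_of_commute {X : Type*} {x y : FreeGroup X} (h : Commute x y) :
    ∃ (z : FreeGroup X) (i j : ℤ), z ^ i = x ∧ z ^ j = y := by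
  let S : Subgroup (FreeGroup X) := Subgroup.closure {x, y}
  have hS : ∀ a b : S, a * b = b * a := by
    have : IsMulCommutative S := Subgroup.isMulCommutative_closure (by
      rintro a (rfl | rfl) b (rfl | rfl)
      · rfl
      · exact h.eq
      · exact h.symm.eq
      · rfl)
    exact fun a b => mul_comm' a b
  classical
  have hsub : Subsingleton (IsFreeGroup.Generators S) := by
    refine ⟨fun a b => ?_⟩
    have e := IsFreeGroup.mulEquiv S
    have hab : FreeGroup.of a * FreeGroup.of b = FreeGroup.of b * FreeGroup.of a :=
      e.injective (by rw [_root_.map_mul, _root_.map_mul, hS])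
    have := congrArg FreeGroup.toWord hab
    by_contra hne
    simp [FreeGroup.toWord_mul, FreeGroup.reduce.cons] at this
    exact hne this.1
  have hcyc : IsCyclic S := by
    rcases isEmpty_or_nonempty (IsFreeGroup.Generators S) with he | ⟨⟨a⟩⟩
    · have : IsCyclic (FreeGroup (IsFreeGroup.Generators S)) := inferInstance
      exact isCyclic_of_surjective _ (IsFreeGroup.mulEquiv S).surjective
    · have : Unique (IsFreeGroup.Generators S) := ⟨⟨a⟩, fun b => Subsingleton.elim _ _⟩
      exact isCyclic_of_surjective _ (IsFreeGroup.mulEquiv S).surjective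
  obtain ⟨z, hz⟩ := hcyc.exists_generator
  obtain ⟨i, hi⟩ := hz ⟨x, Subgroup.subset_closure (by simp)⟩
  obtain ⟨j, hj⟩ := hz ⟨y, Subgroup.subset_closure (by simp)⟩
  exact ⟨z, i, j, by simpa using congrArg Subtype.val hi, by simpa using congrArg Subtype.val hj⟩

/-- In an extension of a free group by a finite group, the centralizer of an element of infinite
order has rank one. -/
theorem exists_pow_eq_zpow_of_commute {X Q : Type*} [Group Q] [Finite Q]
    (α : Q →* MulAut (FreeGroup X)) {x y : FreeGroup X ⋊[α] Q} (hxy : Commute x y)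
    (hx : ∀ n : ℕ, n ≠ 0 → x ^ n ≠ 1) : ∃ (l : ℕ) (t : ℤ), l ≠ 0 ∧ y ^ l = x ^ t := by
  set n := Nat.card Q
  have hn : n ≠ 0 := Nat.card_pos.ne'
  have key : ∀ w : FreeGroup X ⋊[α] Q, ∃ v : FreeGroup X, SemidirectProduct.inl v = w ^ n := by
    intro w
    have : w ^ n ∈ (SemidirectProduct.inl : FreeGroup X →* FreeGroup X ⋊[α] Q).range := by
      rw [SemidirectProduct.range_inl_eq_ker_rightHom, MonoidHom.mem_ker, map_pow]
      exact pow_card_eq_one'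
    exact this
  obtain ⟨v, hv⟩ := key x
  obtain ⟨w, hw⟩ := key y
  have hvw : Commute v w := by
    apply SemidirectProduct.inl_injective (φ := α)
    rw [map_mul, map_mul, hv, hw]
    exact (hxy.pow_pow n n).eq
  obtain ⟨z, i, j, hi, hj⟩ := FreeGroup.exists_zpow_of_commute hvw
  have hi0 : i ≠ 0 := by
    rintro rfl
    apply hx n hn
    rw [← hv, ← hi]
    simp
  have hpow : y ^ ((n : ℤ) * i) = x ^ ((n : ℤ) * j) := by
    rw [zpow_mul, zpow_mul, zpow_natCast, zpow_natCast, ← hv, ← hw, ← map_zpow, ← map_zpow,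
      ← hi, ← hj, ← zpow_mul, ← zpow_mul, mul_comm]
  have hni : ((n : ℤ) * i) ≠ 0 := mul_ne_zero (by exact_mod_cast hn) hi0
  refine ⟨((n : ℤ) * i).natAbs, ((n : ℤ) * i).sign * ((n : ℤ) * j), Int.natAbs_ne_zero.2 hni, ?_⟩
  rw [← zpow_natCast, ← Int.sign_mul_self_eq_natAbs, mul_comm, zpow_mul, hpow, ← zpow_mul, mul_comm]

section CosetProduct

variable {Q : Type*} [Group Q] (D : Subgroup Q)

/-- The action of `Q` on the free group on the cosets of `D` by left translation of the cosets. -/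
def cosetAut : Q →* MulAut (FreeGroup (Q ⧸ D)) where
  toFun q := FreeGroup.freeGroupCongr (MulAction.toPerm q)
  map_one' := by
    ext x
    induction x <;> simp_all
  map_mul' q r := by
    ext x
    induction x <;> simp_all [mul_smul]

/-- The semidirect product of the free group on the cosets of `D` and `Q`. It is the HNN extension
of `Q` with a stable letter that centralizes `D`. -/
abbrev CosetProduct : Type _ := FreeGroup (Q ⧸ D) ⋊[cosetAut D] Q

@[simp]
theorem cosetAut_of (q : Q) (x : Q ⧸ D) : cosetAut D q (.of x) = .of (q • x) := by
  simp [cosetAut]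

namespace CosetProduct

/-- The stable letter. -/
def stable : CosetProduct D := SemidirectProduct.inl (.of ((1 : Q) : Q ⧸ D))

theorem commute_stable {d : Q} (hd : d ∈ D) :
    Commute (stable D) (SemidirectProduct.inr d : CosetProduct D) := by
  have : d • ((1 : Q) : Q ⧸ D) = ((1 : Q) : Q ⧸ D) := by
    rw [MulAction.Quotient.smul_coe, smul_eq_mul, mul_one, QuotientGroup.eq]
    simpa using hd
  ext <;> simp [stable, this]

/-- The word in the free group on the cosets of `D` that is the first coordinate of the product
`q * (t b₁ t⁻¹ a₁) * ⋯ * (t bₖ t⁻¹ aₖ)`, where `t` is the stable letter. -/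
def word : Q → List (Q × Q) → List ((Q ⧸ D) × Bool)
  | _, [] => []
  | q, (b, a) :: L => ((q : Q ⧸ D), true) :: (((q * b : Q) : Q ⧸ D), false) :: word (q * b * a) L

theorem left_eq_mk_word (q : Q) (L : List (Q × Q)) :
    (SemidirectProduct.inr q * (L.map fun s => stable D * SemidirectProduct.inr s.1 *
      (stable D)⁻¹ * SemidirectProduct.inr s.2).prod : CosetProduct D).left =
      FreeGroup.mk (word D q L) := by
  induction L generalizing q with
  | nil => simp [word, FreeGroup.one_eq_mk]
  | cons s L ih =>
    obtain ⟨b, a⟩ := s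
    have h1 : (SemidirectProduct.inr q * (stable D * SemidirectProduct.inr b *
        (stable D)⁻¹ * SemidirectProduct.inr a) : CosetProduct D) =
        SemidirectProduct.inl (.of (q : Q ⧸ D) * (.of ((q * b : Q) : Q ⧸ D))⁻¹) *
          SemidirectProduct.inr (q * b * a) := by
      ext <;> simp [stable, mul_assoc]
    rw [List.map_cons, List.prod_cons, ← mul_assoc, h1, mul_assoc, SemidirectProduct.mul_left, ih]
    simp [word, FreeGroup.of, FreeGroup.invRev]

theorem isReduced_word (q : Q) (L : List (Q × Q)) (hb : ∀ s ∈ L, s.1 ∉ D)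
    (ha : L.IsChain fun s _ => s.2 ∉ D) : FreeGroup.IsReduced (word D q L) := by
  induction L generalizing q with
  | nil => simp [word]
  | cons s L ih =>
    obtain ⟨b, a⟩ := s
    have hb1 : b ∉ D := hb _ List.mem_cons_self
    have ih := ih (q * b * a) (fun s hs => hb s (List.mem_cons_of_mem _ hs)) ha.tail
    have h1 : (q : Q ⧸ D) ≠ ((q * b : Q) : Q ⧸ D) := by
      rw [Ne, QuotientGroup.eq]; simpa using hb1
    match L, ha, ih with
    | [], _, _ => simp [word, FreeGroup.IsReduced, h1]
    | (b', a') :: L, ha, ih =>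
      have h2 : ((q * b : Q) : Q ⧸ D) ≠ ((q * b * a : Q) : Q ⧸ D) := by
        rw [Ne, QuotientGroup.eq]
        simpa [mul_assoc] using (List.isChain_cons_cons.1 ha).1
      simp only [word, FreeGroup.IsReduced, List.isChain_cons_cons] at ih ⊢
      exact ⟨fun h => absurd h h1, fun h => absurd h h2, ih⟩

/-- Britton's lemma for the HNN extension `CosetProduct D`. -/
theorem left_ne_one (q : Q) (L : List (Q × Q)) (hL : L ≠ []) (hb : ∀ s ∈ L, s.1 ∉ D)
    (ha : L.IsChain fun s _ => s.2 ∉ D) :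
    (SemidirectProduct.inr q * (L.map fun s => stable D * SemidirectProduct.inr s.1 *
      (stable D)⁻¹ * SemidirectProduct.inr s.2).prod : CosetProduct D).left ≠ 1 := by
  classical
  rw [left_eq_mk_word, Ne, ← FreeGroup.toWord_eq_nil_iff, FreeGroup.toWord_mk,
    (isReduced_word D q L hb ha).reduce_eq]
  match L, hL with
  | s :: L, _ => simp [word]

/-- A homomorphism of groups that maps `D` into `D'` induces a homomorphism of the semidirect
products. -/
def map {Q' : Type*} [Group Q'] {D} {D' : Subgroup Q'} (f : Q →* Q') (h : D ≤ D'.comap f) :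
    CosetProduct D →* CosetProduct D' :=
  SemidirectProduct.map
    (FreeGroup.map (Quotient.map' f (by
      intro a b hab
      rw [QuotientGroup.leftRel_apply] at hab ⊢
      simpa using h hab))) f (by
      intro q
      ext x
      induction x using QuotientGroup.induction_on with
      | H x =>
        simp only [MonoidHom.comp_apply, MulEquiv.coe_toMonoidHom, cosetAut_of,
          FreeGroup.map.of]
        congr 1
        change ((f (q * x) : Q') : Q' ⧸ D') = ((f q * f x : Q') : Q' ⧸ D')
        rw [map_mul])

theorem map_inr {Q' : Type*} [Group Q'] {D} {D' : Subgroup Q'} (f : Q →* Q')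
    (h : D ≤ D'.comap f) (q : Q) :
    map f h (SemidirectProduct.inr q) = SemidirectProduct.inr (f q) := by
  simp [map]

theorem map_stable {Q' : Type*} [Group Q'] {D} {D' : Subgroup Q'} (f : Q →* Q')
    (h : D ≤ D'.comap f) : map f h (stable D) = stable D' := by
  simp only [map, stable, SemidirectProduct.map_inl, FreeGroup.map.of]
  change SemidirectProduct.inl (FreeGroup.of ((f 1 : Q') : Q' ⧸ D')) = _
  rw [map_one]

end CosetProduct

theorem isResiduallyP_cosetProduct {p : ℕ} [Fact p.Prime] [Finite Q] (hQ : IsPGroup p Q) :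
    IsResiduallyP p (CosetProduct D) :=
  isResiduallyP_semidirectProduct _ hQ (isResiduallyP_freeGroup p _)

end CosetProduct

/-! ### Amalgamated products and their virtually free quotients -/

section Amalgam

variable {G : Type u} [Group G]

/-- An internal description of a group `G` as the amalgamated product of its subgroups `𝒜` and `ℬ`
with amalgamated subgroup `𝒞`. The universal property is only stated for those pairs of
homomorphisms on `𝒜` and `ℬ` which arise from one homomorphism `π` on `G` by conjugating its
restriction to `ℬ` by an element `t` that centralizes the image of `𝒞`. -/
structure IsAmalgam (𝒜 ℬ 𝒞 : Subgroup G) : Prop where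
  le_left : 𝒞 ≤ 𝒜
  le_right : 𝒞 ≤ ℬ
  sup_eq_top : 𝒜 ⊔ ℬ = ⊤
  exists_twist : ∀ (T : Type u) [Group T] (π : G →* T) (t : T), (∀ c ∈ 𝒞, Commute t (π c)) →
    ∃ θ : G →* T, (∀ a ∈ 𝒜, θ a = π a) ∧ ∀ b ∈ ℬ, θ b = t * π b * t⁻¹

/-- The pro-`p` topology of the ambient group separates the elements of `𝒜` from `1`, and those
outside `𝒞` from `𝒞`. -/
structure IsPFiltered (p : ℕ) (𝒜 𝒞 : Subgroup G) : Prop where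
  exists_notMem : ∀ x ∈ 𝒜, x ≠ 1 → ∃ N, IsPNormal p N ∧ x ∉ N
  exists_notMem_sup : ∀ x ∈ 𝒜, x ∉ 𝒞 → ∃ N, IsPNormal p N ∧ x ∉ 𝒞 ⊔ N

/-- The product `b₁ a₁ b₂ a₂ ⋯ bₖ aₖ` of a list of pairs `(bᵢ, aᵢ)`. -/
def pairProd (L : List (G × G)) : G := (L.map fun s => s.1 * s.2).prod

@[simp] theorem pairProd_nil : pairProd ([] : List (G × G)) = 1 := rfl

@[simp] theorem pairProd_cons (b a : G) (L : List (G × G)) :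
    pairProd ((b, a) :: L) = b * a * pairProd L := by simp [pairProd]

@[simp] theorem pairProd_append (L M : List (G × G)) :
    pairProd (L ++ M) = pairProd L * pairProd M := by simp [pairProd]

theorem pairProd_flatten_replicate (L : List (G × G)) (n : ℕ) :
    pairProd (List.replicate n L).flatten = pairProd L ^ n := by
  induction n with
  | zero => simp
  | succ n ih => rw [List.replicate_succ, List.flatten_cons, pairProd_append, ih, pow_succ']

theorem List.isChain_of_forall_mem {α : Type*} {P : α → Prop} {L : List α} (h : ∀ s ∈ L, P s) :
    L.IsChain fun s _ => P s :=
  List.isChain_iff_getElem.2 fun _ _ => h _ (List.getElem_mem _)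

variable {𝒜 ℬ 𝒞 : Subgroup G} {p : ℕ}

namespace IsAmalgam

theorem symm (h : IsAmalgam 𝒜 ℬ 𝒞) : IsAmalgam ℬ 𝒜 𝒞 where
  le_left := h.le_right
  le_right := h.le_left
  sup_eq_top := by rw [sup_comm, h.sup_eq_top]
  exists_twist T _ π t ht := by
    obtain ⟨θ, h1, h2⟩ := h.exists_twist T π t⁻¹ fun c hc => (ht c hc).inv_left
    refine ⟨(MulAut.conj t).toMonoidHom.comp θ, fun b hb => ?_, fun a ha => ?_⟩
    · simp [h2 b hb, mul_assoc]
    · simp [h1 a ha]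

theorem hom_ext (h : IsAmalgam 𝒜 ℬ 𝒞) {T : Type*} [Group T] {f g : G →* T}
    (hA : ∀ a ∈ 𝒜, f a = g a) (hB : ∀ b ∈ ℬ, f b = g b) : f = g := by
  have : 𝒜 ⊔ ℬ ≤ f.eqLocus g := sup_le hA hB
  rw [h.sup_eq_top] at this
  exact MonoidHom.ext fun x => this (Subgroup.mem_top x)

@[elab_as_elim]
theorem induction_mul_left (h : IsAmalgam 𝒜 ℬ 𝒞) {P : G → Prop} (g : G) (one : P 1)
    (left : ∀ a ∈ 𝒜, ∀ g, P g → P (a * g)) (right : ∀ b ∈ ℬ, ∀ g, P g → P (b * g)) : P g := by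
  have hg : g ∈ Subgroup.closure ((𝒜 : Set G) ∪ ℬ) := by
    rw [← Subgroup.sup_eq_closure, h.sup_eq_top]; trivial
  induction hg using Subgroup.closure_induction_left with
  | one => exact one
  | mul_left x hx y _ ih => exact hx.elim (left x · y ih) (right x · y ih)
  | inv_mul_cancel x hx y _ ih =>
    exact hx.elim (fun hx => left _ (inv_mem hx) y ih) (fun hx => right _ (inv_mem hx) y ih)

/-- Every element is the product of an element of `𝒜` and a reduced alternating product. -/
theorem exists_reduced (h : IsAmalgam 𝒜 ℬ 𝒞) (g : G) : ∃ a ∈ 𝒜, ∃ L : List (G × G),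
    g = a * pairProd L ∧ (∀ s ∈ L, s.1 ∈ ℬ ∧ s.2 ∈ 𝒜) ∧ (∀ s ∈ L, s.1 ∉ 𝒞) ∧
      L.IsChain fun s _ => s.2 ∉ 𝒞 := by
  induction g using h.induction_mul_left with
  | one => exact ⟨1, one_mem _, [], by simp⟩
  | left a' ha' g ih =>
    obtain ⟨a, ha, L, rfl, hL⟩ := ih
    exact ⟨a' * a, mul_mem ha' ha, L, by rw [mul_assoc], hL⟩
  | right b hb g ih =>
    obtain ⟨a, ha, L, rfl, hL, hb', ha'⟩ := ih
    by_cases hbC : b ∈ 𝒞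
    · exact ⟨b * a, mul_mem (h.le_left hbC) ha, L, by rw [mul_assoc], hL, hb', ha'⟩
    by_cases haC : a ∈ 𝒞
    · match L with
      | [] => exact ⟨1, one_mem _, [(b, a)], by simp, by simp [hb, ha], by simp [hbC], by simp⟩
      | (b₁, a₁) :: L =>
        have hm := hL _ List.mem_cons_self
        have hB : b * a * b₁ ∈ ℬ := mul_mem (mul_mem hb (h.le_right haC)) hm.1
        by_cases hC : b * a * b₁ ∈ 𝒞
        · refine ⟨b * a * b₁ * a₁, mul_mem (h.le_left hC) hm.2, L, by simp [mul_assoc],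
            fun s hs => hL s (List.mem_cons_of_mem _ hs),
            fun s hs => hb' s (List.mem_cons_of_mem _ hs), ha'.tail⟩
        · refine ⟨1, one_mem _, (b * a * b₁, a₁) :: L, by simp [mul_assoc], ?_, ?_, ?_⟩
          · rintro s (_ | ⟨_, hs⟩)
            · exact ⟨hB, hm.2⟩
            · exact hL s (List.mem_cons_of_mem _ hs)
          · rintro s (_ | ⟨_, hs⟩)
            · exact hC
            · exact hb' s (List.mem_cons_of_mem _ hs)
          · rw [List.isChain_cons] at ha' ⊢
            exact ha'
    · refine ⟨1, one_mem _, (b, a) :: L, by simp [mul_assoc], ?_, ?_, ?_⟩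
      · rintro s (_ | ⟨_, hs⟩)
        · exact ⟨hb, ha⟩
        · exact hL s hs
      · rintro s (_ | ⟨_, hs⟩)
        · exact hbC
        · exact hb' s hs
      · rw [List.isChain_cons]
        exact ⟨fun _ _ => haC, ha'⟩

/-- Every element is conjugate to an element of one of the factors, or to a cyclically reduced
alternating product. -/
theorem exists_isConj (h : IsAmalgam 𝒜 ℬ 𝒞) (g : G) :
    (∃ x, IsConj g x ∧ (x ∈ 𝒜 ∨ x ∈ ℬ)) ∨ ∃ L : List (G × G), L ≠ [] ∧
      IsConj g (pairProd L) ∧ (∀ s ∈ L, s.1 ∈ ℬ ∧ s.2 ∈ 𝒜) ∧ ∀ s ∈ L, s.1 ∉ 𝒞 ∧ s.2 ∉ 𝒞 := by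
  have conj_comm : ∀ x y : G, IsConj (x * y) (y * x) := fun x y =>
    isConj_iff.2 ⟨x⁻¹, by group⟩
  have key : ∀ (n : ℕ) (L : List (G × G)), L.length = n → (∀ s ∈ L, s.1 ∈ ℬ ∧ s.2 ∈ 𝒜) →
      IsConj g (pairProd L) →
      (∃ x, IsConj g x ∧ (x ∈ 𝒜 ∨ x ∈ ℬ)) ∨ ∃ L : List (G × G), L ≠ [] ∧
      IsConj g (pairProd L) ∧ (∀ s ∈ L, s.1 ∈ ℬ ∧ s.2 ∈ 𝒜) ∧ ∀ s ∈ L, s.1 ∉ 𝒞 ∧ s.2 ∉ 𝒞 := by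
    intro n
    induction n with
    | zero =>
      intro L hn _ hg
      rw [List.length_eq_zero_iff.1 hn] at hg
      exact .inl ⟨1, hg, .inl (one_mem _)⟩
    | succ n ih =>
      intro L hn hL hg
      by_cases hgood : ∀ s ∈ L, s.1 ∉ 𝒞 ∧ s.2 ∉ 𝒞
      · exact .inr ⟨L, by rintro rfl; simp at hn, hg, hL, hgood⟩
      -- Rotate the word so that it starts with a pair that has a letter in `𝒞`, and absorb this
      -- letter into its cyclic neighbours.
      push Not at hgood
      obtain ⟨⟨b, a⟩, hs, hba⟩ := hgood
      obtain ⟨hb, ha⟩ : b ∈ ℬ ∧ a ∈ 𝒜 := hL _ hs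
      obtain ⟨L₁, L₂, rfl⟩ := List.append_of_mem hs
      set M := L₂ ++ L₁ with hM
      have hML : ∀ s ∈ M, s.1 ∈ ℬ ∧ s.2 ∈ 𝒜 := fun s hs => hL s (by
        simp only [hM, List.mem_append, List.mem_cons] at hs ⊢; tauto)
      have hMn : M.length = n := by
        simp only [hM, List.length_append, List.length_cons] at hn ⊢; omega
      have hgM : IsConj g (b * a * pairProd M) := by
        refine hg.trans ?_
        rw [pairProd_append]
        refine (conj_comm _ _).trans ?_
        rw [hM, pairProd_cons, pairProd_append, mul_assoc (b * a)]
      clear_value M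
      by_cases hbC : b ∈ 𝒞
      · rcases M.eq_nil_or_concat with rfl | ⟨M', ⟨b', a'⟩, rfl⟩
        · exact .inl ⟨b * a, by simpa using hgM, .inl (mul_mem (h.le_left hbC) ha)⟩
        · rw [List.concat_eq_append] at hML hMn hgM
          have hm := hML (b', a') (by simp)
          refine ih (M' ++ [(b', a' * (b * a))]) (by simpa using hMn) ?_ ?_
          · intro s hs
            rcases List.mem_append.1 hs with hs | hs
            · exact hML s (List.mem_append_left _ hs)
            · rw [List.mem_singleton.1 hs]
              exact ⟨hm.1, mul_mem hm.2 (mul_mem (h.le_left hbC) ha)⟩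
          · have heq : pairProd (M' ++ [(b', a' * (b * a))]) =
                pairProd (M' ++ [(b', a')]) * (b * a) := by simp [mul_assoc]
            rw [heq]
            exact hgM.trans (conj_comm _ _)
      · have haC := hba hbC
        match M with
        | [] => exact .inl ⟨b * a, by simpa using hgM, .inr (mul_mem hb (h.le_right haC))⟩
        | (b', a') :: M' =>
          have hm := hML _ List.mem_cons_self
          refine ih ((b * a * b', a') :: M') (by simpa using hMn) ?_ ?_
          · rintro s (_ | ⟨_, hs⟩)
            · exact ⟨mul_mem (mul_mem hb (h.le_right haC)) hm.1, hm.2⟩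
            · exact hML s (List.mem_cons_of_mem _ hs)
          · simpa [mul_assoc] using hgM
  obtain ⟨a, ha, L, rfl, hL, -, -⟩ := h.exists_reduced g
  rcases L.eq_nil_or_concat with rfl | ⟨L', ⟨b', a'⟩, rfl⟩
  · exact .inl ⟨a, by rw [pairProd_nil, mul_one], .inl ha⟩
  · rw [List.concat_eq_append] at hL key ⊢
    have hm := hL (b', a') (by simp)
    refine key _ (L' ++ [(b', a' * a)]) rfl ?_ ?_
    · intro s hs
      rcases List.mem_append.1 hs with hs | hs
      · exact hL s (List.mem_append_left _ hs)
      · rw [List.mem_singleton.1 hs]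
        exact ⟨hm.1, mul_mem hm.2 ha⟩
    · have heq : pairProd (L' ++ [(b', a' * a)]) = pairProd (L' ++ [(b', a')]) * a := by
        simp [mul_assoc]
      rw [heq]
      exact conj_comm _ _

section ToCosetProduct

theorem exists_toCosetProduct (h : IsAmalgam 𝒜 ℬ 𝒞) (N : Subgroup G) [N.Normal] :
    ∃ θ : G →* CosetProduct (𝒞.map (QuotientGroup.mk' N)),
      (∀ a ∈ 𝒜, θ a = SemidirectProduct.inr (a : G ⧸ N)) ∧
      ∀ b ∈ ℬ, θ b = CosetProduct.stable _ * SemidirectProduct.inr (b : G ⧸ N) *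
        (CosetProduct.stable _)⁻¹ :=
  h.exists_twist _ (SemidirectProduct.inr.comp (QuotientGroup.mk' N)) _ fun _ hc =>
    CosetProduct.commute_stable _ (Subgroup.mem_map_of_mem _ hc)

/-- The homomorphism from the amalgamated product to the semidirect product of the free group on
the cosets of `𝒞 N / N` and `G / N` which reduces `𝒜` modulo `N`, and `ℬ` modulo `N` up to
conjugation by the stable letter. -/
noncomputable def toCosetProduct (h : IsAmalgam 𝒜 ℬ 𝒞) (N : Subgroup G) [N.Normal] :
    G →* CosetProduct (𝒞.map (QuotientGroup.mk' N)) :=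
  (h.exists_toCosetProduct N).choose

variable (h : IsAmalgam 𝒜 ℬ 𝒞) (N : Subgroup G) [N.Normal]

theorem toCosetProduct_left {a : G} (ha : a ∈ 𝒜) :
    h.toCosetProduct N a = SemidirectProduct.inr (a : G ⧸ N) :=
  (h.exists_toCosetProduct N).choose_spec.1 a ha

theorem toCosetProduct_right {b : G} (hb : b ∈ ℬ) :
    h.toCosetProduct N b = CosetProduct.stable _ * SemidirectProduct.inr (b : G ⧸ N) *
      (CosetProduct.stable _)⁻¹ :=
  (h.exists_toCosetProduct N).choose_spec.2 b hb

theorem right_toCosetProduct (g : G) : (h.toCosetProduct N g).right = g := by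
  have : SemidirectProduct.rightHom.comp (h.toCosetProduct N) = QuotientGroup.mk' N := by
    apply h.hom_ext
    · intro a ha; simp [toCosetProduct_left h N ha]
    · intro b hb; simp [toCosetProduct_right h N hb, CosetProduct.stable]
  exact DFunLike.congr_fun this g

/-- An alternating product that stays reduced modulo `N` has a nontrivial free coordinate. -/
theorem left_toCosetProduct_ne_one {a : G} (ha : a ∈ 𝒜) {L : List (G × G)} (hL : L ≠ [])
    (hmem : ∀ s ∈ L, s.1 ∈ ℬ ∧ s.2 ∈ 𝒜) (hb : ∀ s ∈ L, s.1 ∉ 𝒞 ⊔ N)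
    (hch : L.IsChain fun s _ => s.2 ∉ 𝒞 ⊔ N) :
    (h.toCosetProduct N (a * pairProd L)).left ≠ 1 := by
  have hD : ∀ x : G, (x : G ⧸ N) ∈ 𝒞.map (QuotientGroup.mk' N) ↔ x ∈ 𝒞 ⊔ N := by
    intro x
    have := Subgroup.comap_map_eq (QuotientGroup.mk' N) 𝒞
    rw [QuotientGroup.ker_mk'] at this
    rw [← this]
    rfl
  have key := CosetProduct.left_ne_one (𝒞.map (QuotientGroup.mk' N)) (a : G ⧸ N)
    (L.map fun s => ((s.1 : G ⧸ N), (s.2 : G ⧸ N))) (by simpa using hL)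
    (by
      intro s hs
      obtain ⟨r, hr, rfl⟩ := List.mem_map.1 hs
      rw [hD]
      exact hb r hr)
    ((List.isChain_map _).2 (hch.imp fun s _ hs => by rwa [hD]))
  have heq : h.toCosetProduct N (a * pairProd L) = SemidirectProduct.inr (a : G ⧸ N) *
      ((L.map fun s => ((s.1 : G ⧸ N), (s.2 : G ⧸ N))).map fun s =>
        CosetProduct.stable _ * SemidirectProduct.inr s.1 *
          (CosetProduct.stable _)⁻¹ * SemidirectProduct.inr s.2).prod := by
    rw [map_mul, toCosetProduct_left h N ha, pairProd, map_list_prod, List.map_map, List.map_map]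
    congr 2
    refine List.map_congr_left fun s hs => ?_
    simp only [Function.comp_apply, map_mul]
    rw [toCosetProduct_right h N (hmem s hs).1, toCosetProduct_left h N (hmem s hs).2]
  rw [heq]
  exact key

theorem exists_map_toCosetProduct {M : Subgroup G} [M.Normal] (hM : M ≤ N) :
    ∃ ρ : CosetProduct (𝒞.map (QuotientGroup.mk' M)) →*
      CosetProduct (𝒞.map (QuotientGroup.mk' N)),
      ∀ g, ρ (h.toCosetProduct M g) = h.toCosetProduct N g := by
  let f : G ⧸ M →* G ⧸ N := QuotientGroup.map M N (MonoidHom.id G) hM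
  have hf : 𝒞.map (QuotientGroup.mk' M) ≤ (𝒞.map (QuotientGroup.mk' N)).comap f := by
    rintro _ ⟨c, hc, rfl⟩
    exact ⟨c, hc, rfl⟩
  have hfg : ∀ g : G, f (g : G ⧸ M) = g := fun g => rfl
  refine ⟨CosetProduct.map f hf, fun g => ?_⟩
  have : (CosetProduct.map f hf).comp (h.toCosetProduct M) = h.toCosetProduct N := by
    apply h.hom_ext
    · intro a ha
      rw [MonoidHom.comp_apply, toCosetProduct_left h M ha, toCosetProduct_left h N ha,
        CosetProduct.map_inr, hfg]
    · intro b hb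
      rw [MonoidHom.comp_apply, toCosetProduct_right h M hb, toCosetProduct_right h N hb,
        map_mul, map_mul, map_inv, CosetProduct.map_inr, CosetProduct.map_stable, hfg]
  exact DFunLike.congr_fun this g

theorem isResiduallyP_target [Fact p.Prime] (hN : IsPNormal p N) :
    IsResiduallyP p (CosetProduct (𝒞.map (QuotientGroup.mk' N))) := by
  have := hN.finiteIndex
  exact isResiduallyP_cosetProduct _ hN.isPGroup

end ToCosetProduct

/-- The letters outside `𝒞` of finitely many pairs stay outside `𝒞` modulo a common normal
subgroup of `p`-power index. -/
theorem exists_forall_notMem_sup [Fact p.Prime] (hA : IsPFiltered p 𝒜 𝒞) (hB : IsPFiltered p ℬ 𝒞)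
    {L : List (G × G)} (hmem : ∀ s ∈ L, s.1 ∈ ℬ ∧ s.2 ∈ 𝒜) :
    ∃ N, IsPNormal p N ∧ ∀ s ∈ L, (s.1 ∉ 𝒞 → s.1 ∉ 𝒞 ⊔ N) ∧ (s.2 ∉ 𝒞 → s.2 ∉ 𝒞 ⊔ N) := by
  have hanti : ∀ (x : G) (M N : Subgroup G), M ≤ N → x ∉ 𝒞 ⊔ N → x ∉ 𝒞 ⊔ M :=
    fun x M N hMN hx hx' => hx (sup_le_sup_left hMN _ hx')
  have hone : ∀ (x : G) (X : Subgroup G), IsPFiltered p X 𝒞 → x ∈ X →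
      ∃ N, IsPNormal p N ∧ (x ∉ 𝒞 → x ∉ 𝒞 ⊔ N) := by
    intro x X hX hx
    by_cases hxC : x ∈ 𝒞
    · exact ⟨⊤, .top, fun h => absurd hxC h⟩
    · obtain ⟨N, hN, hxN⟩ := hX.exists_notMem_sup x hx hxC
      exact ⟨N, hN, fun _ => hxN⟩
  refine IsPNormal.exists_forall_finite (s := {s | s ∈ L}) L.finite_toSet
    (r := fun s N => (s.1 ∉ 𝒞 → s.1 ∉ 𝒞 ⊔ N) ∧ (s.2 ∉ 𝒞 → s.2 ∉ 𝒞 ⊔ N)) ?_ ?_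
  · exact fun s M N hMN hs => ⟨fun h => hanti _ _ _ hMN (hs.1 h), fun h => hanti _ _ _ hMN (hs.2 h)⟩
  · intro s hs
    obtain ⟨N, hN, h1⟩ := hone s.1 ℬ hB (hmem s hs).1
    obtain ⟨M, hM, h2⟩ := hone s.2 𝒜 hA (hmem s hs).2
    exact ⟨N ⊓ M, hN.inf hM, fun h => hanti _ _ _ inf_le_left (h1 h),
      fun h => hanti _ _ _ inf_le_right (h2 h)⟩

/-- A cyclically reduced alternating product has infinite order in a suitable semidirect
product. -/
theorem exists_toCosetProduct_pow_ne_one [Fact p.Prime] (h : IsAmalgam 𝒜 ℬ 𝒞)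
    (hA : IsPFiltered p 𝒜 𝒞) (hB : IsPFiltered p ℬ 𝒞) {L : List (G × G)} (hL : L ≠ [])
    (hmem : ∀ s ∈ L, s.1 ∈ ℬ ∧ s.2 ∈ 𝒜) (hC : ∀ s ∈ L, s.1 ∉ 𝒞 ∧ s.2 ∉ 𝒞) :
    ∃ (N : Subgroup G) (_ : N.Normal), IsPNormal p N ∧
      ∀ n : ℕ, n ≠ 0 → h.toCosetProduct N (pairProd L) ^ n ≠ 1 := by
  obtain ⟨N, hN, hNL⟩ := exists_forall_notMem_sup hA hB hmem
  have := hN.1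
  refine ⟨N, hN.1, hN, fun n hn heq => ?_⟩
  have hsub : ∀ s ∈ (List.replicate n L).flatten, s ∈ L := by
    intro s hs
    obtain ⟨M, hM, hs⟩ := List.mem_flatten.1 hs
    rwa [List.eq_of_mem_replicate hM] at hs
  refine h.left_toCosetProduct_ne_one N (one_mem 𝒜) (L := (List.replicate n L).flatten) ?_
    (fun s hs => hmem s (hsub s hs))
    (fun s hs => (hNL s (hsub s hs)).1 (hC s (hsub s hs)).1)
    (List.isChain_of_forall_mem fun s hs => (hNL s (hsub s hs)).2 (hC s (hsub s hs)).2) ?_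
  · obtain ⟨m, rfl⟩ := Nat.exists_eq_succ_of_ne_zero hn
    simp [List.replicate_succ, hL]
  · rw [one_mul, pairProd_flatten_replicate, map_pow, heq, SemidirectProduct.one_left]

theorem exists_toCosetProduct_ne_one [Fact p.Prime] (h : IsAmalgam 𝒜 ℬ 𝒞)
    (hA : IsPFiltered p 𝒜 𝒞) (hB : IsPFiltered p ℬ 𝒞) {g : G} (hg : g ≠ 1) :
    ∃ (N : Subgroup G) (_ : N.Normal), IsPNormal p N ∧ h.toCosetProduct N g ≠ 1 := by
  rcases h.exists_isConj g with ⟨x, hgx, hx⟩ | ⟨L, hL, hgL, hmem, hC⟩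
  · have hx1 : x ≠ 1 := by
      rintro rfl
      exact hg (isConj_one_left.1 hgx)
    obtain ⟨N, hN, hxN⟩ : ∃ N, IsPNormal p N ∧ x ∉ N :=
      hx.elim (hA.exists_notMem x · hx1) (hB.exists_notMem x · hx1)
    have := hN.1
    refine ⟨N, hN.1, hN, fun h1 => hxN ?_⟩
    have h2 := MonoidHom.map_isConj (h.toCosetProduct N) hgx
    rw [h1, isConj_one_right] at h2
    rw [← QuotientGroup.eq_one_iff, ← h.right_toCosetProduct N x, h2, SemidirectProduct.one_right]
  · obtain ⟨N, hNn, hN, hpow⟩ := h.exists_toCosetProduct_pow_ne_one hA hB hL hmem hC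
    refine ⟨N, hNn, hN, fun h1 => hpow 1 one_ne_zero ?_⟩
    have h2 := MonoidHom.map_isConj (h.toCosetProduct N) hgL
    rw [h1, isConj_one_right] at h2
    rw [pow_one, h2]

theorem isResiduallyP [Fact p.Prime] (h : IsAmalgam 𝒜 ℬ 𝒞)
    (hA : IsPFiltered p 𝒜 𝒞) (hB : IsPFiltered p ℬ 𝒞) : IsResiduallyP p G := by
  intro g hg
  obtain ⟨N, _, hN, hgN⟩ := h.exists_toCosetProduct_ne_one hA hB hg
  obtain ⟨M, hM, hgM⟩ := isResiduallyP_target N hN _ hgN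
  exact ⟨_, hM.comap (h.toCosetProduct N), hgM⟩

/-- The closure of a subgroup of a factor is contained in that factor: the image of the factor in
the semidirect product is finite, hence closed. -/
theorem pClosure_le_left [Fact p.Prime] (h : IsAmalgam 𝒜 ℬ 𝒞) (hA : IsPFiltered p 𝒜 𝒞)
    (hB : IsPFiltered p ℬ 𝒞) {F : Subgroup G} (hF : F ≤ 𝒜) : pClosure p F ≤ 𝒜 := by
  intro g hg
  by_contra hgA
  obtain ⟨a, ha, L, rfl, hmem, hb, hch⟩ := h.exists_reduced g
  have hL : L ≠ [] := by
    rintro rfl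
    exact hgA (by simpa using ha)
  obtain ⟨N, hN, hNL⟩ := exists_forall_notMem_sup hA hB hmem
  have := hN.1
  have := hN.finiteIndex
  have hleft := h.left_toCosetProduct_ne_one N ha hL hmem (fun s hs => (hNL s hs).1 (hb s hs))
    (hch.imp_of_mem_imp fun s _ hs _ hsC => (hNL s hs).2 hsC)
  set x := h.toCosetProduct N (a * pairProd L)
  obtain ⟨M, hM, hxM⟩ := IsPNormal.exists_forall_finite (p := p)
    (s := (Set.univ : Set (G ⧸ N))) Set.finite_univ
    (r := fun q M => (SemidirectProduct.inr q)⁻¹ * x ∉ M) (fun _ _ _ hMN hx hx' => hx (hMN hx'))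
    (fun q _ => isResiduallyP_target N hN _ fun hq => hleft (by
      rw [← inv_mul_eq_one.1 hq, SemidirectProduct.left_inr]))
  obtain ⟨_, ⟨f, hf, rfl⟩, hfM⟩ :=
    mem_pClosure.1 (map_mem_pClosure (h.toCosetProduct N) hg) M hM
  rw [h.toCosetProduct_left N (hF hf)] at hfM
  exact hxM _ (Set.mem_univ _) hfM

/-- If `f` has infinite order in one of the semidirect products, then every element of the closure of
the cyclic subgroup generated by `f` has a power with nonzero exponent in that subgroup. -/
theorem exists_pow_eq_zpow_of_mem_pClosure [Fact p.Prime] (h : IsAmalgam 𝒜 ℬ 𝒞)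
    (hA : IsPFiltered p 𝒜 𝒞) (hB : IsPFiltered p ℬ 𝒞) {f g : G} {N : Subgroup G} [N.Normal]
    (hN : IsPNormal p N) (hf : ∀ n : ℕ, n ≠ 0 → h.toCosetProduct N f ^ n ≠ 1)
    (hg : g ∈ pClosure p (Subgroup.zpowers f)) : ∃ (l : ℕ) (t : ℤ), l ≠ 0 ∧ g ^ l = f ^ t := by
  have hcomm := commute_of_mem_pClosure (h.isResiduallyP hA hB) hg
  have := hN.finiteIndex
  obtain ⟨l, t, hl, hlt⟩ := exists_pow_eq_zpow_of_commute _ (hcomm.map (h.toCosetProduct N)) hf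
  refine ⟨l, t, hl, ?_⟩
  -- The element `u` dies modulo `N`. Modulo a smaller `M`, it becomes a torsion element of the
  -- closure of an infinite cyclic group, so it dies there as well.
  set u := g ^ l * (f ^ t)⁻¹ with hu
  suffices hu1 : u = 1 from mul_inv_eq_one.1 hu1
  have huN : h.toCosetProduct N u = 1 := by
    rw [hu, map_mul, map_pow, map_inv, map_zpow, hlt, mul_inv_cancel]
  have hucl : u ∈ pClosure p (Subgroup.zpowers f) :=
    mul_mem (pow_mem hg _) (inv_mem (le_pClosure _ ⟨t, rfl⟩))
  have hucomm := commute_of_mem_pClosure (h.isResiduallyP hA hB) hucl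
  by_contra hne
  obtain ⟨N', _, hN', huN'⟩ := h.exists_toCosetProduct_ne_one hA hB hne
  have hM := hN.inf hN'
  have := hM.1
  have := hM.finiteIndex
  obtain ⟨ρ, hρ⟩ := h.exists_map_toCosetProduct N (M := N ⊓ N') inf_le_left
  obtain ⟨ρ', hρ'⟩ := h.exists_map_toCosetProduct N' (M := N ⊓ N') inf_le_right
  have hfM : ∀ n : ℕ, n ≠ 0 → h.toCosetProduct (N ⊓ N') f ^ n ≠ 1 := by
    intro n hn h1
    apply hf n hn
    rw [← hρ, ← map_pow, h1, map_one]
  obtain ⟨i, j, hi, hij⟩ :=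
    exists_pow_eq_zpow_of_commute _ (hucomm.map (h.toCosetProduct (N ⊓ N'))) hfM
  have hj : j = 0 := by
    have h1 := congrArg ρ hij
    rw [map_pow, map_zpow, hρ, hρ, huN, one_pow] at h1
    by_contra hj
    apply hf j.natAbs (Int.natAbs_ne_zero.2 hj)
    rcases Int.natAbs_eq j with h2 | h2
    · rw [← zpow_natCast, ← h2, h1]
    · rw [← zpow_natCast, ← inv_inj, ← zpow_neg, ← h2, ← h1, inv_one]
  rw [hj, zpow_zero] at hij
  have hcl := map_mem_pClosure (h.toCosetProduct (N ⊓ N')) hucl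
  rw [MonoidHom.map_zpowers] at hcl
  have h1 := eq_one_of_mem_pClosure_of_pow_eq_one (isResiduallyP_target (N ⊓ N') hM) hfM hcl hi hij
  apply huN'
  rw [← hρ', h1, map_one]

/-- A `p'`-isolated cyclic subgroup which is not conjugate into a factor is closed, and one that is
conjugate into a factor is closed if it is closed relative to that factor. -/
theorem pClosure_le_of_isPPrimeIsolated [Fact p.Prime] (h : IsAmalgam 𝒜 ℬ 𝒞)
    (hA : IsPFiltered p 𝒜 𝒞) (hB : IsPFiltered p ℬ 𝒞) {F : Subgroup G} (hcyc : IsCyclic F)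
    (hiso : IsPPrimeIsolated p F)
    (hFA : ∀ x, F.map (MulAut.conj x).toMonoidHom ≤ 𝒜 →
      pClosure p (F.map (MulAut.conj x).toMonoidHom) ⊓ 𝒜 ≤ F.map (MulAut.conj x).toMonoidHom)
    (hFB : ∀ x, F.map (MulAut.conj x).toMonoidHom ≤ ℬ →
      pClosure p (F.map (MulAut.conj x).toMonoidHom) ⊓ ℬ ≤ F.map (MulAut.conj x).toMonoidHom) :
    pClosure p F ≤ F := by
  obtain ⟨f, rfl⟩ := (Subgroup.isCyclic_iff_exists_zpowers_eq_top F).1 hcyc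
  have hmap : ∀ x, (Subgroup.zpowers f).map (MulAut.conj x).toMonoidHom =
      Subgroup.zpowers (x * f * x⁻¹) := fun x => by
    rw [MonoidHom.map_zpowers]; simp
  rcases h.exists_isConj f with ⟨y, hfy, hy⟩ | ⟨L, hL, hfL, hmem, hC⟩
  · obtain ⟨x, rfl⟩ := isConj_iff.1 hfy
    apply pClosure_map_conj _ x
    rcases hy with hy | hy
    · have hle : (Subgroup.zpowers f).map (MulAut.conj x).toMonoidHom ≤ 𝒜 := by
        rwa [hmap, Subgroup.zpowers_le]
      exact (le_inf le_rfl (h.pClosure_le_left hA hB hle)).trans (hFA x hle)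
    · have hle : (Subgroup.zpowers f).map (MulAut.conj x).toMonoidHom ≤ ℬ := by
        rwa [hmap, Subgroup.zpowers_le]
      exact (le_inf le_rfl (h.symm.pClosure_le_left hB hA hle)).trans (hFB x hle)
  · obtain ⟨N, _, hN, hpow⟩ := h.exists_toCosetProduct_pow_ne_one hA hB hL hmem hC
    have hfN : ∀ n : ℕ, n ≠ 0 → h.toCosetProduct N f ^ n ≠ 1 := by
      intro n hn h1
      have h2 := (MonoidHom.map_isConj (h.toCosetProduct N) hfL).pow n
      rw [h1, isConj_one_right] at h2
      exact hpow n hn h2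
    have hf : ∀ n : ℕ, n ≠ 0 → f ^ n ≠ 1 := fun n hn h1 => hfN n hn (by
      rw [← map_pow, h1, map_one])
    intro g hg
    obtain ⟨l, t, hl, hlt⟩ := h.exists_pow_eq_zpow_of_mem_pClosure hA hB hN hfN hg
    obtain ⟨r, hr, hpr, hgr⟩ :=
      exists_pow_mem_zpowers_of_mem_pClosure (h.isResiduallyP hA hB) hf hg hl hlt
    exact hiso.mem_of_pow_mem hr hpr hgr

end IsAmalgam

end Amalgam

/-! ### The amalgamated product as a quotient of the free product -/

namespace AmalgamatedProduct

variable {A : Type u} {B : Type v} [Group A] [Group B] {H : Subgroup A} {K : Subgroup B}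
  (φ : H ≃* K)

theorem inl_eq_inr (x : H) : inl φ x = inr φ (φ x) :=
  QuotientGroup.eq_iff_div_mem.2 (by
    rw [div_eq_mul_inv]
    exact Subgroup.subset_normalClosure ⟨x, rfl⟩)

theorem exists_lift {T : Type*} [Group T] (α : A →* T) (β : B →* T)
    (h : ∀ x : H, α x = β (φ x)) :
    ∃ θ : AmalgamatedProduct φ →* T, (∀ a, θ (inl φ a) = α a) ∧ ∀ b, θ (inr φ b) = β b := by
  refine ⟨QuotientGroup.lift _ (Monoid.Coprod.lift α β) ?_, fun a => ?_, fun b => ?_⟩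
  · intro x hx
    have hle : Subgroup.normalClosure (Set.range fun h : H =>
        (Monoid.Coprod.inl (h : A) * (Monoid.Coprod.inr (φ h : B))⁻¹ : Monoid.Coprod A B)) ≤
        (Monoid.Coprod.lift α β).ker := by
      apply Subgroup.normalClosure_le_normal
      rintro _ ⟨y, rfl⟩
      simp [MonoidHom.mem_ker, h]
    exact hle hx
  · simp [inl]
  · simp [inr]

theorem map_inr_eq_map_inl : K.map (inr φ) = H.map (inl φ) := by
  ext x
  constructor
  · rintro ⟨k, hk, rfl⟩
    exact ⟨φ.symm ⟨k, hk⟩, (φ.symm ⟨k, hk⟩).2, by rw [inl_eq_inr]; simp⟩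
  · rintro ⟨y, hy, rfl⟩
    exact ⟨φ ⟨y, hy⟩, (φ ⟨y, hy⟩).2, (inl_eq_inr φ ⟨y, hy⟩).symm⟩

theorem isAmalgam : IsAmalgam (inl φ).range (inr φ).range (H.map (inl φ)) where
  le_left := Subgroup.map_le_range _ _
  le_right := by rw [← map_inr_eq_map_inl]; exact Subgroup.map_le_range _ _
  sup_eq_top := by
    have h := Monoid.Coprod.range_inl_sup_range_inr (G := A) (H := B)
    rw [inl, inr, MonoidHom.range_comp, MonoidHom.range_comp, ← Subgroup.map_sup, h,
      ← MonoidHom.range_eq_map, QuotientGroup.range_mk']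
  exists_twist T _ π t ht := by
    obtain ⟨θ, h1, h2⟩ := exists_lift φ (π.comp (inl φ))
      ((MulAut.conj t).toMonoidHom.comp (π.comp (inr φ))) (by
        intro x
        have h := (ht _ (Subgroup.mem_map_of_mem (inl φ) x.2)).eq
        simp only [MonoidHom.comp_apply, MulEquiv.coe_toMonoidHom, MulAut.conj_apply,
          ← inl_eq_inr]
        rw [h, mul_inv_cancel_right])
    refine ⟨θ, ?_, ?_⟩
    · rintro _ ⟨a, rfl⟩; exact h1 a
    · rintro _ ⟨b, rfl⟩; exact h2 b

variable {φ}

theorem mem_omegaPLeft {p : ℕ} {R : Subgroup A} :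
    R ∈ omegaPLeft p φ ↔ ∃ N, IsPNormal p N ∧ N.comap (inl φ) = R := by
  constructor
  · rintro ⟨_, ⟨N, h1, h2, rfl⟩, rfl⟩
    exact ⟨N, ⟨h1, h2⟩, rfl⟩
  · rintro ⟨N, ⟨h1, h2⟩, rfl⟩
    exact ⟨_, ⟨N, h1, h2, rfl⟩, rfl⟩

theorem mem_omegaPRight {p : ℕ} {R : Subgroup B} :
    R ∈ omegaPRight p φ ↔ ∃ N, IsPNormal p N ∧ N.comap (inr φ) = R := by
  constructor
  · rintro ⟨_, ⟨N, h1, h2, rfl⟩, rfl⟩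
    exact ⟨N, ⟨h1, h2⟩, rfl⟩
  · rintro ⟨N, ⟨h1, h2⟩, rfl⟩
    exact ⟨_, ⟨N, h1, h2, rfl⟩, rfl⟩

end AmalgamatedProduct

/-! ### Families of subgroups of the factors -/

section Trace

variable {X : Type*} {G : Type*} [Group X] [Group G] {i : X →* G} {p : ℕ}
  {Ω : Set (Subgroup X)}

theorem exists_notMem_sup_of_separableByFamily
    (hΩ : ∀ R, R ∈ Ω ↔ ∃ N, IsPNormal p N ∧ N.comap i = R) {L : Subgroup X}
    (hL : SeparableByFamily L Ω) {x : X} (hx : x ∉ L) :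
    ∃ N, IsPNormal p N ∧ i x ∉ L.map i ⊔ N := by
  have hx' : x ∉ ⋂ N ∈ Ω, (L : Set X) * (N : Set X) := by rwa [hL]
  simp only [Set.mem_iInter, not_forall] at hx'
  obtain ⟨R, hR, hxR⟩ := hx'
  obtain ⟨N, hN, rfl⟩ := (hΩ R).1 hR
  have := hN.1
  refine ⟨N, hN, fun hmem => hxR ?_⟩
  obtain ⟨_, ⟨l, hl, rfl⟩, n, hn, hln⟩ := Subgroup.mem_sup_of_normal_right.1 hmem
  refine Set.mem_mul.2 ⟨l, hl, l⁻¹ * x, ?_, by simp⟩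
  change i (l⁻¹ * x) ∈ N
  rw [map_mul, map_inv, ← hln, inv_mul_cancel_left]
  exact hn

theorem exists_notMem_of_sInf_eq_bot
    (hΩ : ∀ R, R ∈ Ω ↔ ∃ N, IsPNormal p N ∧ N.comap i = R) (hbot : sInf Ω = ⊥) {x : X}
    (hx : x ≠ 1) : ∃ N, IsPNormal p N ∧ i x ∉ N := by
  have hx' : x ∉ sInf Ω := by rwa [hbot, Subgroup.mem_bot]
  simp only [Subgroup.mem_sInf, not_forall] at hx'
  obtain ⟨R, hR, hxR⟩ := hx'
  obtain ⟨N, hN, rfl⟩ := (hΩ R).1 hR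
  exact ⟨N, hN, hxR⟩

theorem IsSubgroupFiltration.isPFiltered
    {X : Type u} {G : Type*} [Group X] [Group G] {i : X →* G} {Ω : Set (Subgroup X)}
    (hΩ : ∀ R, R ∈ Ω ↔ ∃ N, IsPNormal p N ∧ N.comap i = R) {Y : Subgroup X}
    (h : IsSubgroupFiltration Ω Y) : IsPFiltered p i.range (Y.map i) where
  exists_notMem := by
    rintro _ ⟨x, rfl⟩ hx
    exact exists_notMem_of_sInf_eq_bot hΩ h.2.1 fun h1 => hx (by rw [h1, map_one])
  exists_notMem_sup := by
    rintro _ ⟨x, rfl⟩ hx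
    exact exists_notMem_sup_of_separableByFamily hΩ h.2.2 fun h1 =>
      hx (Subgroup.mem_map_of_mem i h1)

/-- A conjugate `F'` of `F` in the range of `i` is closed relative to this range, unless its
preimage is a `p'`-isolated cyclic subgroup that is not separable by the family `Ω`. -/
theorem pClosure_inf_range_le {F : Subgroup G} (hcyc : IsCyclic F) (hiso : IsPPrimeIsolated p F)
    (hΩ : ∀ R, R ∈ Ω ↔ ∃ N, IsPNormal p N ∧ N.comap i = R) (hbot : sInf Ω = ⊥)
    (hΛ : ∀ L : Subgroup X, IsCyclic L → IsPPrimeIsolated p L → ¬ SeparableByFamily L Ω →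
      ¬ AreConjugate F (L.map i)) (x : G) (hx : F.map (MulAut.conj x).toMonoidHom ≤ i.range) :
    pClosure p (F.map (MulAut.conj x).toMonoidHom) ⊓ i.range ≤
      F.map (MulAut.conj x).toMonoidHom := by
  set F' := F.map (MulAut.conj x).toMonoidHom with hF'
  have hinj : Function.Injective i := by
    rw [injective_iff_map_eq_one]
    intro a ha
    by_contra hne
    obtain ⟨N, -, hN⟩ := exists_notMem_of_sInf_eq_bot hΩ hbot hne
    exact hN (ha ▸ one_mem N)
  have hmap : (F'.comap i).map i = F' := Subgroup.map_comap_eq_self hx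
  have hcyc' : IsCyclic F' :=
    isCyclic_of_surjective _ (F.equivMapOfInjective _ (MulAut.conj x).injective).surjective
  have hL : IsCyclic (F'.comap i) := by
    have : IsCyclic ((F'.comap i).map i) := by rwa [hmap]
    exact isCyclic_of_surjective _ ((F'.comap i).equivMapOfInjective i hinj).symm.surjective
  have hLiso : IsPPrimeIsolated p (F'.comap i) := by
    intro g q hq hqp hg
    obtain ⟨f, hf, hfg⟩ := hg
    have h1 : (MulAut.conj x).symm (i g) ∈ F := by
      refine hiso _ q hq hqp ?_
      rw [← map_pow, ← map_pow, ← hfg]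
      simpa [mul_assoc] using hf
    exact ⟨_, h1, by simp [mul_assoc]⟩
  have hsep : SeparableByFamily (F'.comap i) Ω := by
    by_contra hns
    refine hΛ _ hL hLiso hns ⟨x⁻¹, ?_⟩
    rw [hmap, hF', Subgroup.map_map]
    ext y
    simp [Subgroup.mem_map, mul_assoc]
  rintro _ ⟨hcl, ⟨a, rfl⟩⟩
  by_contra ha
  obtain ⟨N, hN, haN⟩ := exists_notMem_sup_of_separableByFamily hΩ hsep (x := a) ha
  rw [hmap] at haN
  exact haN ((iInf₂_le N hN : pClosure p F' ≤ F' ⊔ N) hcl)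

end Trace

theorem theorem1p6 {A : Type u} {B : Type v} [Group A] [Group B]
    (H : Subgroup A) (K : Subgroup B) (φ : H ≃* K) (p : ℕ) (hp : p.Prime)
    (hA : IsSubgroupFiltration (omegaPLeft p φ) H)
    (hB : IsSubgroupFiltration (omegaPRight p φ) K)
    (F : Subgroup (AmalgamatedProduct φ)) (hcyc : IsCyclic F) (hiso : IsPPrimeIsolated p F)
    (hΛA : ∀ L ∈ lambdaPLeft p φ, ¬ AreConjugate F (L.map (AmalgamatedProduct.inl φ)))
    (hΛB : ∀ L ∈ lambdaPRight p φ, ¬ AreConjugate F (L.map (AmalgamatedProduct.inr φ))) :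
    IsPSeparable p F := by
  have : Fact p.Prime := ⟨hp⟩
  have hΩA := fun R => AmalgamatedProduct.mem_omegaPLeft (φ := φ) (p := p) (R := R)
  have hΩB := fun R => AmalgamatedProduct.mem_omegaPRight (φ := φ) (p := p) (R := R)
  have hB' := hB.isPFiltered hΩB
  rw [AmalgamatedProduct.map_inr_eq_map_inl] at hB'
  apply isPSeparable_of_pClosure_le
  exact (AmalgamatedProduct.isAmalgam φ).pClosure_le_of_isPPrimeIsolated (hA.isPFiltered hΩA) hB'
    hcyc hiso
    (pClosure_inf_range_le hcyc hiso hΩA hA.2.1 fun L h1 h2 h3 => hΛA L ⟨h1, h2, h3⟩)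
    (pClosure_inf_range_le hcyc hiso hΩB hB.2.1 fun L h1 h2 h3 => hΛB L ⟨h1, h2, h3⟩)
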